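/- **Algorithm.** Let $d\ge 1$, $f:\mathbb R^d\to\mathbb R$, and let $\log^+\theta=\max\{1,\log\theta\}$, $B_R(z)=\{x:\|x-z\|\le R\}$. A *centre routine* is a map that assigns to a region $S$ a point $\mathrm{Centre}(S)$, with $\mathrm{Centre}(S)\in S$ if $S$ is nonempty, compact and convex, and that depends in a Borel way on the data (ball and half-spaces) describing $S$. Fix $e\neq0$ in $\mathbb R^d$. *CuttingPlaneMethod*$(\hat f,x^{(0)},R,N)$: put $S^{(0)}=B_R(x^{(0)})\cap H(x^{(0)})$ and, for $t=1,\dots,N$, $x^{(t)}=\mathrm{Centre}(S^{(t-1)})$, $S^{(t)}=S^{(t-1)}\cap H(x^{(t)})$. Here $H(x)=\{x':\nabla\hat f(x)^T(x'-x)\le 0\}$, with $e$ in place of $\nabla\hat f(x)$ if $\nabla\hat f(x)=0$. *Cutting plane assumption*, for $\tau\in(0,1/2]$: for all differentiable $\hat f$, all $x^{(0)}$, $R>0$ and $N\ge1$ the method yields $\mathrm{vol}(S^{(N)})\le(1-\tau)^N\,\mathrm{vol}(B_R(0))$; a call of Centre takes time $T_C$. *ExploitNC*$(f,c,s,R)$: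 return $c+\theta_*s$, where $\theta_*$ minimises $f(c+\theta s)$ over $\theta\in\{12R,9R,-9R,-12R\}$. *CuttingTrustRegion*$(f,z,\epsilon,L_1,L_3,R)$: put $\alpha=21L_3R^2$, $\hat f(x)=f(x)+\frac\alpha2\|z-x\|^2$, $\hat\epsilon=\epsilon/2$, $\hat L_1=L_1+\alpha$, $N=\lceil\frac d\tau\log^+(16\hat L_1R/\hat\epsilon)\rceil$. Run CuttingPlaneMethod$(\hat f,z,R,N)$ and let $x_{\rm best}$ minimise $\hat f$ over $x^{(0)},\dots,x^{(N)}$. - If $\|\nabla\hat f(x_{\rm best})\|\le\hat\epsilon$, put $u=x_{\rm best}$, $v=\emptyset$, $K=0$. Otherwise let $y=x_{\rm best}-\hat L_1^{-1}\nabla\hat f(x_{\rm best})$ and draw independent uniform points of $B_{\hat\epsilon/(8\hat L_1)}(y)$ until one, $u$, lies outside $S^{(N)}$; $K$ is the number of draws. If $\|u-z\|\le R$, let $v$ be the first $x^{(t)}$ with $\hat f(u)<\hat f(x^{(t)})+\nabla\hat f(x^{(t)})^T(u-x^{(t)})$; otherwise (or if there is no such $t$) $v=\emptyset$. - If $\|\nabla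 f(u)\|\le\epsilon$, compute $p$ minimising $p^T\nabla^2f(u)p$ over $\|p\|=1$ (by a Borel routine); return $u$ if $p^T\nabla^2f(u)p\ge-\alpha$, and ExploitNC$(f,u,p,R)$ otherwise. - If $\|\nabla f(u)\|>\epsilon$, return $u$ if $v=\emptyset$, and ExploitNC$(f,\frac{u+v}2,\frac{v-u}{\|v-u\|},R)$ otherwise. **Time.** $T_p$ ($p=1,2$) is the time for evaluating $f$ and its first $p$ derivatives at a point. Elementary vector and scalar operations and drawing a uniform point of a ball take time at most $cd$; a singular value decomposition takes time at most $cd^\omega$ with $\omega\in[2,3]$; $d\le cT_1$. The time of the procedure includes testing the termination conditions below at every $z^{(t)}$. **Theorem.** For every $\rho>0$ and $c\ge 0$ there is a constant $C>0$, depending only on $\rho$ and $c$, such that the following holds. Let the cutting plane assumption hold, let $f$ have $L_1$-Lipschitz first and $L_3$-Lipschitz third derivatives (that is, for $p=1,3$, $f$ is $C^p$ and $|q^{(p)}(0)-q^{(p)}(\theta)|\le L_p|\theta|$ for every $q(\theta)=f(x+\theta s)$ with $\|s\|\le1$), where $L_1,L_3>0$. Let $\epsilon>0$, let $f$ be bounded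 below and $f(z^{(0)})-\inf f\le\Delta$. Iterate $$z^{(t+1)}\gets\text{CuttingTrustRegion}(f,z^{(t)},\epsilon,L_1,L_3,R),\qquad R=\rho\,L_3^{-1/3}\epsilon^{1/3}.$$ Then there is a positive random variable $\bar K$ with $\mathbf P(\bar K\ge y)\le e^{(1-y)/10}$ for all $y\in\mathbb R$ such that, almost surely, the procedure finds a point $z^{(m)}$ with $$\|\nabla f(z^{(m)})\|\le\epsilon,\qquad \lambda_{\min}(\nabla^2f(z^{(m)}))\ge-21\rho^2L_3^{1/3}\epsilon^{2/3},$$ and the computation time up to the first such $m$ is at most $$C\,\bigl(\Delta L_3^{1/3}\epsilon^{-4/3}+1\bigr)\Bigl(\frac{(T_C+T_1+\bar Kd)\,d}{\tau}\log^+\frac{L_1^3}{\epsilon^2L_3}+T_2+d^\omega\Bigr).$$ In particular, $\rho=1/\sqrt{21}$ gives $\lambda_{\min}\ge-L_3^{1/3}\epsilon^{2/3}$, and $\rho=1/3$ gives $\lambda_{\min}\ge-\frac73L_3^{1/3}\epsilon^{2/3}$. -/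

import Mathlib

open MeasureTheory ProbabilityTheory
open scoped NNReal ENNReal

noncomputable section

namespace CutNC

/-- `ℝᵈ` with the Euclidean norm. -/
abbrev Vec (d : ℕ) : Type := EuclideanSpace ℝ (Fin d)

/-- `log⁺ θ = max {1, log θ}`. -/
def logPlus (θ : ℝ) : ℝ := max 1 (Real.log θ)

/-- `f : ℝᵈ → ℝ` has `L`-Lipschitz `p`-th derivatives: `f` is `C^p`, and along every line
`q θ = f (x + θ s)` with `‖s‖ ≤ 1` one has `|q⁽ᵖ⁾(0) - q⁽ᵖ⁾(θ)| ≤ L |θ|`. -/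
def HasLipschitzDeriv {d : ℕ} (p : ℕ) (L : ℝ) (f : Vec d → ℝ) : Prop :=
  ContDiff ℝ p f ∧ ∀ x s : Vec d, ‖s‖ ≤ 1 → ∀ θ : ℝ,
    |iteratedDeriv p (fun t : ℝ => f (x + t • s)) 0
      - iteratedDeriv p (fun t : ℝ => f (x + t • s)) θ| ≤ L * |θ|

/-- The Hessian `∇²f(x)` as a linear operator. -/
def hessian {d : ℕ} (f : Vec d → ℝ) (x : Vec d) : Vec d →L[ℝ] Vec d :=
  fderiv ℝ (gradient f) x

/-- The minimum eigenvalue (of a symmetric operator). -/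
def lamMin {d : ℕ} (A : Vec d →L[ℝ] Vec d) : ℝ :=
  sInf {μ : ℝ | Module.End.HasEigenvalue (A : Vec d →ₗ[ℝ] Vec d) μ}

/-! ### Timed computations -/

/-- A result together with the time spent on computing it (`⊤` if the computation diverges). -/
structure Timed (α : Type) where
  val : α
  time : ℝ≥0∞

/-- Sequential composition adds the times. -/
instance : Monad Timed where
  pure a := ⟨a, 0⟩
  bind x k := ⟨(k x.val).val, x.time + (k x.val).time⟩

/-- Compute the value `a` at price `t`. -/
def charge {α : Type} (t : ℝ≥0) (a : α) : Timed α := ⟨a, (t : ℝ≥0∞)⟩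

/-- The prices of the primitive operations in dimension `d`.
* `T1`, `T2`: evaluating `f` with its first, respectively first two, derivatives at a point;
* `TC`: one call of the centre routine;
* `c * d`: one elementary operation on vectors (sum, scalar multiple, inner product, norm,
  drawing a uniform point of a ball) or on scalars;
* `c * d ^ ω`: a singular value decomposition of a `d × d` matrix (or another operation that is
  at most as expensive, such as applying a matrix to a vector). -/
structure Prices where
  c : ℝ≥0
  ω : ℝ
  T1 : ℝ≥0
  T2 : ℝ≥0
  TC : ℝ≥0

/-- The price of an elementary vector operation. -/
def Prices.vec (P : Prices) (d : ℕ) : ℝ≥0 := P.c * d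

/-- The price of a singular value decomposition. -/
def Prices.svd (P : Prices) (d : ℕ) : ℝ≥0 := P.c * (d : ℝ≥0) ^ P.ω

/-! ### The cutting plane method -/

/-- What is known about a function at a queried point. -/
structure Query (d : ℕ) where
  point : Vec d
  value : ℝ
  slope : Vec d

/-- Evaluate `g` and `∇g` at `x`, where `g` is `f` plus a multiple of a squared distance: one
evaluation of `f` and `∇f`, and a few vector operations for the additional term. -/
def query {d : ℕ} (P : Prices) (g : Vec d → ℝ) (x : Vec d) : Timed (Query d) :=
  charge (P.T1 + 5 * P.vec d) ⟨x, g x, gradient g x⟩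

open Classical in
/-- The normal of the cut produced by a query: the gradient or, should it vanish, the fixed
direction `e`. -/
def cutNormal {d : ℕ} (e : Vec d) (q : Query d) : Vec d := if q.slope = 0 then e else q.slope

/-- The half-space through the queried point kept by the cut. -/
def cut {d : ℕ} (e : Vec d) (q : Query d) : Set (Vec d) :=
  {x | inner ℝ (cutNormal e q) (x - q.point) ≤ 0}

/-- `CuttingPlaneMethod`: returns the region `S⁽ᴺ⁾` and the queries at `x⁽⁰⁾, …, x⁽ᴺ⁾`. -/
def cuttingPlaneMethod {d : ℕ} (P : Prices) (centre : Set (Vec d) → Vec d) (e : Vec d)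
    (g : Vec d → ℝ) (x₀ : Vec d) (R : ℝ) :
    (N : ℕ) → Timed (Set (Vec d) × (Fin (N + 1) → Query d))
  | 0 => do
      let q ← query P g x₀
      return (Metric.closedBall x₀ R ∩ cut e q, fun _ => q)
  | N + 1 => do
      let (S, qs) ← cuttingPlaneMethod P centre e g x₀ R N
      let x ← charge P.TC (centre S)
      let q ← query P g x
      return (S ∩ cut e q, Fin.snoc (α := fun _ => Query d) qs q)

/-- The part of the ball of radius `R` about `z` that satisfies the linear inequalities
`⟨g, y - x⟩ ≤ 0` for the listed pairs `(x, g)`. -/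
def region {d n : ℕ} (z : Vec d) (R : ℝ) (cuts : Fin n → Vec d × Vec d) : Set (Vec d) :=
  Metric.closedBall z R ∩ {y | ∀ i, inner ℝ (cuts i).2 (y - (cuts i).1) ≤ 0}

/-- The assumption on the centre routine: it picks a point of the region it is given, as a Borel
function of the data describing the region, and after `N` steps the cutting plane method has
reduced the volume to at most `(1 - τ)ᴺ` times that of the initial ball. -/
structure CuttingPlaneAssumption {d : ℕ} (P : Prices) (centre : Set (Vec d) → Vec d)
    (e : Vec d) (τ : ℝ) : Prop where
  tau_pos : 0 < τ
  tau_le : τ ≤ 1 / 2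
  centre_mem : ∀ S : Set (Vec d), S.Nonempty → IsCompact S → Convex ℝ S → centre S ∈ S
  measurable_centre : ∀ (n : ℕ) (R : ℝ),
    Measurable fun p : Vec d × (Fin n → Vec d × Vec d) => centre (region p.1 R p.2)
  volume_le : ∀ (g : Vec d → ℝ) (x₀ : Vec d) (R : ℝ) (N : ℕ), Differentiable ℝ g → 0 < R →
    0 < N → volume (cuttingPlaneMethod P centre e g x₀ R N).val.1 ≤
      ENNReal.ofReal ((1 - τ) ^ N) * volume (Metric.closedBall (0 : Vec d) R)

/-! ### Certificates of nonconvexity and how to exploit them -/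

open Classical in
/-- Go through the random points `u 0, u 1, …` up to the first one outside `S`; every trial has
the same price. Returns that point and the number `K` of trials. -/
def rejectionLoop {d : ℕ} (price : ℝ≥0) (u : ℕ → Vec d) (S : Set (Vec d)) :
    Timed (Vec d × ℕ) :=
  if h : ∃ k, u k ∉ S then
    ⟨(u (Nat.find h), Nat.find h + 1), ((Nat.find h + 1 : ℕ) : ℝ≥0∞) * (price : ℝ≥0∞)⟩
  else ⟨(u 0, 0), ⊤⟩

open Classical in
/-- `NonconvexityCertificate`: returns `u`, `v` (where `none` stands for `∅`) and `K`.
`ξ` lists the random points of the unit ball, so that `y + r ξ` are points of `B_r(y)`. -/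
def nonconvexityCertificate {d N : ℕ} (P : Prices) (g : Vec d → ℝ) (S : Set (Vec d))
    (x₀ : Vec d) (qs : Fin (N + 1) → Query d) (L ε R : ℝ) (ξ : ℕ → Vec d) :
    Timed (Vec d × Option (Vec d) × ℕ) := do
  let best ← charge ((N + 2) * P.vec d)
    (qs (((List.finRange (N + 1)).argmin fun i => (qs i).value).getD 0))
  if ‖best.slope‖ ≤ ε then
    return (best.point, none, 0)
  else
    let y ← charge (3 * P.vec d) (best.point - (1 / L) • best.slope)
    let r := ε / (8 * L)
    -- a trial: draw `u`, test the ball constraint and the `N + 1` cuts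
    let (u, K) ← rejectionLoop ((3 + 2 + 2 * (N + 1)) * P.vec d) (fun k => y + r • ξ k) S
    let inBall ← charge (2 * P.vec d) (decide (‖u - x₀‖ ≤ R))
    if inBall then
      let qu ← query P g u
      let t ← charge (4 * (N + 1) * P.vec d) ((List.finRange (N + 1)).find? fun i =>
        decide (qu.value < (qs i).value + inner ℝ (qs i).slope (u - (qs i).point)))
      return (u, t.map fun i => (qs i).point, K)
    else
      return (u, none, K)

/-- `ExploitNC`: the best of the points `c ± 9 R s`, `c ± 12 R s`. -/
def exploitNC {d : ℕ} (P : Prices) (f : Vec d → ℝ) (c s : Vec d) (R : ℝ) : Timed (Vec d) :=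
  charge (4 * (P.T1 + 3 * P.vec d) + 2 * P.vec d)
    (c + (([12 * R, 9 * R, -9 * R, -12 * R].argmin fun θ => f (c + θ • s)).getD 0) • s)

/-- A routine that returns, for a symmetric operator, a minimiser of `sᵀ A s` over the unit
sphere, as a Borel function of `A`. -/
structure IsMinDirection {d : ℕ} (eig : (Vec d →L[ℝ] Vec d) → Vec d) : Prop where
  measurable : Measurable eig
  norm_eq : ∀ A, ‖eig A‖ = 1
  le : ∀ A : Vec d →L[ℝ] Vec d, (A : Vec d →ₗ[ℝ] Vec d).IsSymmetric →
    ∀ s : Vec d, ‖s‖ = 1 → inner ℝ (eig A) (A (eig A)) ≤ inner ℝ s (A s)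

/-- The number of cutting plane steps: `(d/τ) log⁺ (16 L R / ε)`, rounded up. -/
def numSteps (d : ℕ) (τ L R ε : ℝ) : ℕ := ⌈(d / τ) * logPlus (16 * L * R / ε)⌉₊

open Classical in
/-- `CuttingTrustRegion`: returns `z⁺` and `K`. -/
def cuttingTrustRegion {d : ℕ} (P : Prices) (centre : Set (Vec d) → Vec d) (e : Vec d) (τ : ℝ)
    (eig : (Vec d →L[ℝ] Vec d) → Vec d) (f : Vec d → ℝ) (z : Vec d) (ε L₁ L₃ R : ℝ)
    (ξ : ℕ → Vec d) : Timed (Vec d × ℕ) := do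
  let α := 21 * L₃ * R ^ 2
  let fhat : Vec d → ℝ := fun x => f x + α / 2 * ‖z - x‖ ^ 2
  let εhat := ε / 2
  let Lhat := L₁ + α
  let N ← charge (P.vec d) (numSteps d τ Lhat R εhat)
  let (S, qs) ← cuttingPlaneMethod P centre e fhat z R N
  let (u, v, K) ← nonconvexityCertificate P fhat S z qs Lhat εhat R ξ
  let gu ← charge (P.T1 + P.vec d) (gradient f u)
  if ‖gu‖ ≤ ε then
    let H ← charge P.T2 (hessian f u)
    let p ← charge (P.svd d) (eig H)
    let curv ← charge (P.svd d + P.vec d) (inner ℝ p (H p))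
    if -α ≤ curv then
      return (u, K)
    else
      let zplus ← exploitNC P f u p R
      return (zplus, K)
  else
    match v with
    | none => return (u, K)
    | some v =>
      let mid ← charge (2 * P.vec d) ((1 / 2 : ℝ) • (u + v))
      let s ← charge (3 * P.vec d) ((1 / ‖v - u‖) • (v - u))
      let zplus ← exploitNC P f mid s R
      return (zplus, K)

/-- The termination conditions `‖∇f(z)‖ ≤ ε` and `λ_min(∇²f(z)) ≥ -η`. -/
def IsApproxStationary {d : ℕ} (f : Vec d → ℝ) (ε η : ℝ) (z : Vec d) : Prop :=
  ‖gradient f z‖ ≤ ε ∧ -η ≤ lamMin (hessian f z)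

/-- The first `n` calls `z⁽ᵗ⁺¹⁾ ← CuttingTrustRegion(f, z⁽ᵗ⁾, ε, L₁, L₃, R)`, including the price
of testing the termination conditions at each of `z⁽⁰⁾, …, z⁽ⁿ⁾`. The call number `t` draws its
random points from `ξ t`. -/
def repeatedCalls {d : ℕ} (P : Prices) (centre : Set (Vec d) → Vec d) (e : Vec d) (τ : ℝ)
    (eig : (Vec d →L[ℝ] Vec d) → Vec d) (f : Vec d → ℝ) (z₀ : Vec d) (ε L₁ L₃ R : ℝ)
    (ξ : ℕ → ℕ → Vec d) : ℕ → Timed (Vec d)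
  | 0 => charge (P.T2 + P.svd d + 2 * P.vec d) z₀
  | n + 1 => do
      let z ← repeatedCalls P centre e τ eig f z₀ ε L₁ L₃ R ξ n
      let (zplus, _) ← cuttingTrustRegion P centre e τ eig f z ε L₁ L₃ R (ξ n)
      charge (P.T2 + P.svd d + 2 * P.vec d) zplus

end CutNC

end

/-!
A call works with the penalized objective `f̂ = f + α/2 ‖· - z‖²`. Suppose no query of the cutting
plane method has penalized gradient of norm at most `ε / 2`. After `N` cuts the region `S⁽ᴺ⁾` has
at most half the volume of the small ball around the gradient step `y`, so each draw from that
ball leaves `S⁽ᴺ⁾` with probability at least `1/2`. Every point of the small ball has a smaller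
value of `f̂` than all queries `x⁽ᵗ⁾`. Hence, if the accepted point `u` is in `B_R(z)`, the cut at
some `x⁽ᵗ⁾` excludes it, and the tangent inequality of `f̂` at `x⁽ᵗ⁾` fails at `u`. Then `f̂` is
not convex on the segment from `u` to `v = x⁽ᵗ⁾`, and `f` has curvature below `-α` somewhere on
it.

Curvature at most `-α` in the direction `s`, at distance at most `R` from `c`, makes a third order
Taylor argument along `c + θ s` decrease `f` by a multiple of `L₃ R⁴` at one of `θ = ±9R, ±12R`.
This handles both the pair `u, v` and a stationary `u` with a negative eigenvalue of the Hessian.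
If neither occurs and `u` is not approximately stationary, then either `‖u - z‖ > R` or `f̂` has
gradient at most `ε / 2` at `u` while `f` has gradient above `ε`; both force `u` far from `z`, and
since `f̂ u ≤ f̂ z = f z`, the penalty bounds the decrease of `f` from below. So every call but
the last decreases `f` by a fixed amount, which bounds the number of calls.

The number of draws in a call is geometrically dominated conditionally on the past. Exponential
moments therefore multiply along the calls, and Markov's inequality gives the tail of `K̄`.
-/

namespace CutNC

/-! ### Taylor estimates -/

section Taylor

variable {q : ℝ → ℝ} {L R h : ℝ} {n : ℕ}

theorem abs_le_of_abs_deriv_le_pow {g g' : ℝ → ℝ} {M : ℝ}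
    (hg : ∀ θ, HasDerivAt g (g' θ) θ) (h0 : g 0 = 0) (hb : ∀ θ, |g' θ| ≤ M * |θ| ^ n) (θ : ℝ) :
    |g θ| ≤ M * |θ| ^ (n + 1) / (n + 1) := by
  wlog hθ : 0 ≤ θ generalizing g g' θ
  · have h := this (g := fun x => g (-x)) (g' := fun x => -g' (-x))
      (fun x => by simpa using! (hg (-x)).scomp x (hasDerivAt_neg x)) (by simpa using h0)
      (fun x => by simpa using hb (-x)) (-θ) (by linarith)
    simpa using h
  have hB : ∀ x : ℝ, HasDerivAt (fun x : ℝ => M * x ^ (n + 1) / (n + 1)) (M * x ^ n) x := by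
    intro x
    refine (((hasDerivAt_pow (n + 1) x).const_mul M).div_const ((n : ℝ) + 1)).congr_deriv ?_
    push_cast
    field_simp
  rw [abs_of_nonneg hθ]
  refine image_norm_le_of_norm_deriv_right_le_deriv_boundary (f := g) (a := 0) (b := θ)
    (f' := g') (fun x _ => (hg x).continuousAt.continuousWithinAt)
    (fun x _ => (hg x).hasDerivWithinAt) (by simp [h0]) hB (fun x hx => ?_) ⟨hθ, le_rfl⟩
  simpa only [Real.norm_eq_abs, abs_of_nonneg hx.1] using hb x

theorem hasDerivAt_iteratedDeriv {k : ℕ} (hq : ContDiff ℝ n q) (hk : k < n) (x : ℝ) :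
    HasDerivAt (iteratedDeriv k q) (iteratedDeriv (k + 1) q x) x := by
  rw [iteratedDeriv_succ]
  exact (hq.differentiable_iteratedDeriv k (by exact_mod_cast hk) x).hasDerivAt

theorem hasDerivAt_taylorSum (a : ℕ → ℝ) (m : ℕ) (x : ℝ) :
    HasDerivAt (fun θ => ∑ j ∈ Finset.range (m + 1), a j * θ ^ j / j.factorial)
      (∑ j ∈ Finset.range m, a (j + 1) * x ^ j / j.factorial) x := by
  simp only [Finset.sum_range_succ' _ m]
  simp only [pow_zero, Nat.factorial_zero, Nat.cast_one, div_one, mul_one]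
  refine HasDerivAt.add_const _ (HasDerivAt.fun_sum fun j _ => ?_)
  refine (((hasDerivAt_pow (j + 1) x).const_mul (a (j + 1))).div_const _).congr_deriv ?_
  rw [Nat.factorial_succ]
  push_cast
  field_simp

theorem abs_iteratedDeriv_sub_taylor_le (hq : ContDiff ℝ n q)
    (hL : ∀ θ, |iteratedDeriv n q 0 - iteratedDeriv n q θ| ≤ L * |θ|) (m : ℕ) {k : ℕ}
    (hkm : k + m = n) (θ : ℝ) :
    |iteratedDeriv k q θ - ∑ j ∈ Finset.range (m + 1), iteratedDeriv (k + j) q 0 * θ ^ j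
        / j.factorial| ≤ L * |θ| ^ (m + 1) / (m + 1).factorial := by
  induction m generalizing k θ with
  | zero =>
    obtain rfl : k = n := hkm
    simpa [abs_sub_comm] using hL θ
  | succ m ih =>
    have h := abs_le_of_abs_deriv_le_pow (n := m + 1) (M := L / (m + 1).factorial)
      (fun x => (hasDerivAt_iteratedDeriv (k := k) hq (by omega) x).sub
        (hasDerivAt_taylorSum (fun j => iteratedDeriv (k + j) q 0) (m + 1) x))
      (by simp [Finset.sum_range_succ' _ (m + 1)])
      (fun x => by
        have := ih (k := k + 1) (by omega) x
        simp only [add_assoc, add_comm 1] at this ⊢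
        rwa [div_mul_eq_mul_div]) θ
    refine h.trans_eq ?_
    rw [Nat.factorial_succ (m + 1)]
    push_cast
    field_simp

theorem abs_sub_taylor_le (hq : ContDiff ℝ n q)
    (hL : ∀ θ, |iteratedDeriv n q 0 - iteratedDeriv n q θ| ≤ L * |θ|) (θ : ℝ) :
    |q θ - ∑ j ∈ Finset.range (n + 1), iteratedDeriv j q 0 * θ ^ j / j.factorial| ≤
      L * |θ| ^ (n + 1) / (n + 1).factorial := by
  simpa using abs_iteratedDeriv_sub_taylor_le hq hL n (zero_add n) θ

theorem abs_sub_cubic_le (hq : ContDiff ℝ 3 q)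
    (hL : ∀ θ, |iteratedDeriv 3 q 0 - iteratedDeriv 3 q θ| ≤ L * |θ|) (θ : ℝ) :
    |q θ - (q 0 + iteratedDeriv 1 q 0 * θ + iteratedDeriv 2 q 0 / 2 * θ ^ 2 +
      iteratedDeriv 3 q 0 / 6 * θ ^ 3)| ≤ L / 24 * θ ^ 4 := by
  have := abs_sub_taylor_le (n := 3) hq hL θ
  rw [Even.pow_abs (by decide)] at this
  convert this using 2
  · simp [Finset.sum_range_succ, Nat.factorial]
    ring
  · norm_num [Nat.factorial]
    ring

theorem curvature_le_of_tangent_gt (hL0 : 0 ≤ L) (h0 : 0 < h) (hR : h ≤ R)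
    (hq : ContDiff ℝ 3 q) (hL : ∀ θ, |iteratedDeriv 3 q 0 - iteratedDeriv 3 q θ| ≤ L * |θ|)
    (hc : q (-h) < q h - 2 * h * deriv q h - 2 * (21 * L * R ^ 2) * h ^ 2) :
    iteratedDeriv 2 q 0 + iteratedDeriv 3 q 0 * h / 3 ≤ -(20 * L * R ^ 2) := by
  have upper := (abs_le.1 (abs_sub_taylor_le (n := 3) hq hL h)).2
  have lower := (abs_le.1 (abs_sub_taylor_le (n := 3) hq hL (-h))).1
  have slope := (abs_le.1 (abs_iteratedDeriv_sub_taylor_le (n := 3) hq hL 2 (k := 1) rfl h)).1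
  simp only [Finset.sum_range_succ, Finset.sum_range_zero, iteratedDeriv_zero, iteratedDeriv_one,
    Nat.factorial, abs_neg, abs_of_pos h0, Nat.reduceAdd] at upper lower slope
  norm_num at upper lower slope
  have slope' := mul_le_mul_of_nonneg_left slope (show 0 ≤ 2 * h by positivity)
  have hcurv : 2 * h ^ 2 * (iteratedDeriv 2 q 0 + iteratedDeriv 3 q 0 * h / 3) ≤
      2 * h ^ 2 * (-(21 * L * R ^ 2) + 5 / 24 * L * h ^ 2) := by
    nlinarith
  have hcurv' := le_of_mul_le_mul_left hcurv (by positivity)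
  have hLh : L * h ^ 2 ≤ L * R ^ 2 := by gcongr
  have hLR : 0 ≤ L * R ^ 2 := by positivity
  linarith

/-- The points `θ` at which `exploitNC` evaluates `f (c + θ s)`. -/
def node (R : ℝ) : Fin 4 → ℝ := ![12 * R, 9 * R, -9 * R, -12 * R]

theorem node_mem (R : ℝ) (i : Fin 4) : node R i ∈ [12 * R, 9 * R, -9 * R, -12 * R] := by
  fin_cases i <;> simp [node]

/- With `±9` and `±12` of total weight `1/2` each, all even moments are fixed, and the two remaining
degrees of freedom are spent on the odd ones.  The value of the third moment is the one for which
the mean of a cubic exceeds its value at `-h` by a multiple of `q''(0) + q'''(0) h / 3`. -/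
theorem exists_node_weights (h0 : 0 ≤ h) (hR : h ≤ R) (hR0 : 0 < R) :
    ∃ w ∈ stdSimplex ℝ (Fin 4),
      ∑ i, w i * node R i = -h ∧ ∑ i, w i * node R i ^ 2 = 225 / 2 * R ^ 2 ∧
      ∑ i, w i * node R i ^ 3 = h * (225 / 2 * R ^ 2 - 2 * h ^ 2) ∧
      ∑ i, w i * node R i ^ 4 = 27297 / 2 * R ^ 4 := by
  obtain ⟨x, rfl⟩ : ∃ x, h = x * R := ⟨h / R, by field_simp⟩
  have hx0 : 0 ≤ x := nonneg_of_mul_nonneg_left h0 hR0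
  have hx1 : x ≤ 1 := by simpa [hR0] using hR
  have hx3 : x ^ 3 ≤ x := by simpa using pow_le_pow_of_le_one hx0 hx1 (show 1 ≤ 3 by norm_num)
  have hx3' : 0 ≤ x ^ 3 := by positivity
  set y : ℝ := x * (387 / 2 - 2 * x ^ 2) / 756 with hy
  set v : ℝ := (-x - 12 * y) / 9 with hv
  refine ⟨![(1 / 2 + y) / 2, (1 / 2 + v) / 2, (1 / 2 - v) / 2, (1 / 2 - y) / 2],
    ⟨fun i => ?_, ?_⟩, ?_⟩
  · fin_cases i <;> simp [hv, hy] <;> linarith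
  · simp [Fin.sum_univ_four]
    ring
  · simp only [node, Fin.sum_univ_four, Matrix.cons_val, hv, hy]
    refine ⟨?_, ?_, ?_, ?_⟩ <;> ring

theorem exists_le_sum_stdSimplex {ι : Type*} [Fintype ι] {w : ι → ℝ} (hw : w ∈ stdSimplex ℝ ι)
    (a : ι → ℝ) : ∃ i, a i ≤ ∑ j, w j * a j := by
  by_contra! h
  have hlt : ∑ i, w i * (∑ j, w j * a j) < ∑ i, w i * a i := by
    obtain ⟨i, -, hi⟩ := Finset.exists_ne_zero_of_sum_ne_zero (hw.2.trans_ne one_ne_zero)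
    exact Finset.sum_lt_sum (fun j _ => mul_le_mul_of_nonneg_left (h j).le (hw.1 j))
      ⟨i, Finset.mem_univ i, mul_lt_mul_of_pos_left (h i) ((hw.1 i).lt_of_ne' hi)⟩
  rw [← Finset.sum_mul, hw.2, one_mul] at hlt
  exact hlt.false

theorem exists_node_le_of_curvature_le (hL0 : 0 ≤ L) (h0 : 0 ≤ h) (hR : h ≤ R) (hR0 : 0 < R)
    (hq : ContDiff ℝ 3 q) (hL : ∀ θ, |iteratedDeriv 3 q 0 - iteratedDeriv 3 q θ| ≤ L * |θ|)
    (hc : iteratedDeriv 2 q 0 + iteratedDeriv 3 q 0 * h / 3 ≤ -(20 * L * R ^ 2)) :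
    ∃ θ ∈ [12 * R, 9 * R, -9 * R, -12 * R], q θ ≤ q (-h) - 500 * L * R ^ 4 := by
  obtain ⟨w, hw, moment₁, moment₂, moment₃, moment₄⟩ := exists_node_weights h0 hR hR0
  obtain ⟨i, hi⟩ := exists_le_sum_stdSimplex hw fun i => q (node R i)
  refine ⟨node R i, node_mem R i, hi.trans ?_⟩
  have taylor := abs_sub_cubic_le hq hL
  set a₁ := iteratedDeriv 1 q 0
  set a₂ := iteratedDeriv 2 q 0
  set a₃ := iteratedDeriv 3 q 0
  have mean_le : ∑ j, w j * q (node R j) ≤ q 0 - a₁ * h + a₂ / 2 * (225 / 2 * R ^ 2) +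
      a₃ / 6 * (h * (225 / 2 * R ^ 2 - 2 * h ^ 2)) + L / 24 * (27297 / 2 * R ^ 4) := by
    calc ∑ j, w j * q (node R j)
        ≤ ∑ j, w j * (q 0 + a₁ * node R j + a₂ / 2 * node R j ^ 2 + a₃ / 6 * node R j ^ 3 +
            L / 24 * node R j ^ 4) := by
          gcongr with j
          · exact hw.1 j
          · linarith [(abs_le.1 (taylor (node R j))).2]
      _ = (∑ j, w j) * q 0 + a₁ * ∑ j, w j * node R j + a₂ / 2 * ∑ j, w j * node R j ^ 2 +
            a₃ / 6 * ∑ j, w j * node R j ^ 3 + L / 24 * ∑ j, w j * node R j ^ 4 := by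
          simp only [Finset.mul_sum, Finset.sum_mul, ← Finset.sum_add_distrib]
          exact Finset.sum_congr rfl fun j _ => by ring
      _ = _ := by
          rw [hw.2, moment₁, moment₂, moment₃, moment₄]
          ring
  have lower := (abs_le.1 (taylor (-h))).1
  have hhR : h ^ 2 ≤ R ^ 2 := by gcongr
  have hcurv := mul_le_mul_of_nonneg_left hc (show 0 ≤ (225 / 2 * R ^ 2 - h ^ 2) / 2 by
    linarith [sq_nonneg R])
  have hLh : L * h ^ 4 ≤ L * R ^ 4 := by gcongr
  have hLRh : L * R ^ 2 * h ^ 2 ≤ L * R ^ 2 * R ^ 2 := by gcongr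
  linarith [show 0 ≤ L * R ^ 4 by positivity]

end Taylor

/-! ### The penalized objective and exploitation of nonconvexity -/

section Normed

variable {E : Type*} [NormedAddCommGroup E]

/-- The objective with a quadratic penalty for leaving `z`, to which the cutting plane method is
applied. -/
noncomputable def penalized (f : E → ℝ) (α : ℝ) (z x : E) : ℝ := f x + α / 2 * ‖z - x‖ ^ 2

theorem penalized_self (f : E → ℝ) (α : ℝ) (z : E) : penalized f α z z = f z := by
  simp [penalized]

theorem le_penalized (f : E → ℝ) {α : ℝ} (hα : 0 ≤ α) (z x : E) : f x ≤ penalized f α z x :=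
  le_add_of_nonneg_right (by positivity)

variable [NormedSpace ℝ E]

theorem contDiff_comp_line {n : WithTop ℕ∞} {f : E → ℝ} (hf : ContDiff ℝ n f) (x s : E) :
    ContDiff ℝ n fun t : ℝ => f (x + t • s) :=
  hf.comp (by fun_prop)

theorem hasDerivAt_line (x s : E) (t : ℝ) : HasDerivAt (fun t : ℝ => x + t • s) s t := by
  simpa using ((hasDerivAt_id t).smul_const s).const_add x

theorem midpoint_add_smul_unit {u v : E} (huv : u ≠ v) :
    (1 / 2 : ℝ) • (u + v) + (‖v - u‖ / 2) • (1 / ‖v - u‖) • (v - u) = v ∧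
      (1 / 2 : ℝ) • (u + v) + (-(‖v - u‖ / 2)) • (1 / ‖v - u‖) • (v - u) = u := by
  have hn : ‖v - u‖ ≠ 0 := norm_ne_zero_iff.2 (sub_ne_zero.2 huv.symm)
  have hhalf : (‖v - u‖ / 2) • (1 / ‖v - u‖) • (v - u) = (1 / 2 : ℝ) • (v - u) := by
    rw [smul_smul]
    congr 1
    field_simp
  rw [neg_smul, hhalf]
  constructor <;> module

end Normed

section Calculus

variable {E : Type*} [NormedAddCommGroup E] [InnerProductSpace ℝ E] [CompleteSpace E] {f : E → ℝ}

theorem deriv_comp_line (hf : Differentiable ℝ f) (x s : E) (t : ℝ) :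
    deriv (fun t : ℝ => f (x + t • s)) t = inner ℝ (gradient f (x + t • s)) s := by
  simpa using! ((hf (x + t • s)).hasGradientAt.hasFDerivAt.comp_hasDerivAt t
    (hasDerivAt_line x s t)).deriv

theorem contDiff_gradient {m n : WithTop ℕ∞} (hf : ContDiff ℝ n f) (hmn : m + 1 ≤ n) :
    ContDiff ℝ m (gradient f) :=
  (InnerProductSpace.toDual ℝ E).symm.contDiff.comp (hf.fderiv_right hmn)

theorem iteratedDeriv_two_comp_line (hf : ContDiff ℝ 2 f) (x s : E) :
    iteratedDeriv 2 (fun t : ℝ => f (x + t • s)) 0 = inner ℝ s (fderiv ℝ (gradient f) x s) := by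
  have hgrad : HasFDerivAt (gradient f) (fderiv ℝ (gradient f) x) (x + (0 : ℝ) • s) := by
    simpa using! ((contDiff_gradient hf one_add_one_eq_two.le).differentiable (by simp)
      x).hasFDerivAt
  rw [iteratedDeriv_succ, iteratedDeriv_one,
    funext (deriv_comp_line (hf.differentiable (by simp)) x s)]
  simpa [real_inner_comm, Function.comp_def] using ((hgrad.comp_hasDerivAt (0 : ℝ)
    (hasDerivAt_line x s 0)).inner ℝ (hasDerivAt_const (0 : ℝ) s)).deriv

theorem inner_fderiv_gradient (hf : ContDiff ℝ 2 f) (x v w : E) :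
    inner ℝ (fderiv ℝ (gradient f) x v) w = fderiv ℝ (fderiv ℝ f) x v w := by
  have hd : HasFDerivAt (gradient f) _ x :=
    (InnerProductSpace.toDual ℝ E).symm.toContinuousLinearEquiv.hasFDerivAt.comp x
      ((hf.fderiv_right (m := 1) one_add_one_eq_two.le).differentiable (by simp) x).hasFDerivAt
  rw [hd.fderiv]
  simp

theorem isSymmetric_fderiv_gradient (hf : ContDiff ℝ 2 f) (x : E) :
    (fderiv ℝ (gradient f) x : E →ₗ[ℝ] E).IsSymmetric := by
  intro v w
  have hsymm : IsSymmSndFDerivAt ℝ f x := hf.contDiffAt.isSymmSndFDerivAt (by simp)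
  simp only [ContinuousLinearMap.coe_coe]
  rw [real_inner_comm (fderiv ℝ (gradient f) x w) v, inner_fderiv_gradient hf,
    inner_fderiv_gradient hf, hsymm v w]

theorem hasGradientAt_penalized (hf : Differentiable ℝ f) (α : ℝ) (z x : E) :
    HasGradientAt (penalized f α z) (gradient f x + α • (x - z)) x := by
  have hsq : HasFDerivAt (fun x => ‖z - x‖ ^ 2) _ x := ((hasFDerivAt_id x).const_sub z).norm_sq
  refine ((hf x).hasGradientAt.hasFDerivAt.add (hsq.const_mul (α / 2))).congr_fderiv ?_
  ext v
  simp only [id_eq, add_apply, smul_apply, map_sub, ContinuousLinearMap.comp_neg,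
    ContinuousLinearMap.comp_id, neg_sub, sub_apply, innerSL_apply_apply, smul_eq_mul, map_add,
    map_smulₛₗ, InnerProductSpace.toDual_apply_apply, Real.ringHom_apply]
  ring

theorem gradient_penalized (hf : Differentiable ℝ f) (α : ℝ) (z x : E) :
    gradient (penalized f α z) x = gradient f x + α • (x - z) :=
  (hasGradientAt_penalized hf α z x).gradient

theorem differentiable_penalized (hf : Differentiable ℝ f) (α : ℝ) (z : E) :
    Differentiable ℝ (penalized f α z) :=
  fun x => (hasGradientAt_penalized hf α z x).differentiableAt

theorem penalized_add (hf : Differentiable ℝ f) (α : ℝ) (z x h : E) :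
    penalized f α z (x + h) = penalized f α z x + inner ℝ (gradient (penalized f α z) x) h
      + (f (x + h) - f x - inner ℝ (gradient f x) h) + α / 2 * ‖h‖ ^ 2 := by
  have hsq : ‖z - (x + h)‖ ^ 2 = ‖z - x‖ ^ 2 + 2 * inner ℝ (x - z) h + ‖h‖ ^ 2 := by
    rw [← norm_neg, norm_sub_rev z x, ← norm_add_sq_real]
    congr 2
    abel
  rw [gradient_penalized hf, penalized, penalized, hsq, inner_add_left, real_inner_smul_left]
  ring

theorem penalized_lt_tangent_iff (hf : Differentiable ℝ f) (α : ℝ) (z u v : E) :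
    penalized f α z u < penalized f α z v + inner ℝ (gradient (penalized f α z) v) (u - v) ↔
      f u + α / 2 * ‖u - v‖ ^ 2 < f v + inner ℝ (gradient f v) (u - v) := by
  have h := penalized_add hf α z v (u - v)
  rw [add_sub_cancel] at h
  rw [h]
  constructor <;> intro <;> linarith

end Calculus

section InnerProduct

variable {E : Type*} [NormedAddCommGroup E] [InnerProductSpace ℝ E]

theorem perturbed_gradient_step_lt {g : E → ℝ} {M ε : ℝ} {x v ξ : E} (hM : 0 < M)
    (hg : ∀ h, g (x + h) ≤ g x + inner ℝ v h + M / 2 * ‖h‖ ^ 2) (hε : 0 < ε) (hv : ε < ‖v‖)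
    (hξ : ‖ξ‖ ≤ 1) : g (x - (1 / M) • v + (ε / (8 * M)) • ξ) < g x := by
  have h := hg (-((1 / M) • v) + (ε / (8 * M)) • ξ)
  rw [← add_assoc, ← sub_eq_add_neg] at h
  refine h.trans_lt ?_
  rw [norm_add_sq_real, inner_add_right, inner_neg_right, inner_neg_left, norm_neg, norm_smul,
    norm_smul, real_inner_smul_left, real_inner_smul_right, real_inner_smul_right,
    real_inner_self_eq_norm_sq, Real.norm_of_nonneg (by positivity),
    Real.norm_of_nonneg (by positivity)]
  have hξ2 : ‖ξ‖ ^ 2 ≤ 1 := pow_le_one₀ (norm_nonneg _) hξ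
  have hv2 : ε ^ 2 < ‖v‖ ^ 2 := by gcongr
  have cross_terms_cancel : -(1 / M * ‖v‖ ^ 2) + ε / (8 * M) * inner ℝ v ξ +
      M / 2 * ((1 / M * ‖v‖) ^ 2 + 2 * -(1 / M * (ε / (8 * M) * inner ℝ v ξ)) +
        (ε / (8 * M) * ‖ξ‖) ^ 2) = (ε ^ 2 * ‖ξ‖ ^ 2 / 64 - ‖v‖ ^ 2) / (2 * M) := by
    field_simp
    ring
  have : (ε ^ 2 * ‖ξ‖ ^ 2 / 64 - ‖v‖ ^ 2) / (2 * M) < 0 :=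
    div_neg_of_neg_of_pos (by nlinarith [sq_nonneg ε]) (by positivity)
  linarith

theorem le_sInf_eigenvalues {A : E →L[ℝ] E} {a : ℝ} (ha : a ≤ 0)
    (h : ∀ s : E, ‖s‖ = 1 → a ≤ inner ℝ s (A s)) :
    a ≤ sInf {μ : ℝ | Module.End.HasEigenvalue (A : E →ₗ[ℝ] E) μ} := by
  refine Real.le_sInf (fun μ hμ => ?_) ha
  obtain ⟨v, hv⟩ := hμ.exists_hasEigenvector
  have hv0 : ‖v‖ ≠ 0 := norm_ne_zero_iff.2 hv.2
  have hav := h (‖v‖⁻¹ • v) (by simp [norm_smul, hv0])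
  have hAv : A v = μ • v := hv.apply_eq_smul
  rw [map_smul, hAv, real_inner_smul_left, real_inner_smul_right, real_inner_smul_right,
    real_inner_self_eq_norm_sq] at hav
  convert hav using 1
  field_simp

end InnerProduct

variable {d : ℕ} {f : Vec d → ℝ}

theorem continuous_hessian (hf : ContDiff ℝ 2 f) : Continuous (hessian f) :=
  (contDiff_gradient hf one_add_one_eq_two.le).continuous_fderiv (by simp)

theorem HasLipschitzDeriv.add_le {L : ℝ} (hf : HasLipschitzDeriv 1 L f) (x h : Vec d) :
    f (x + h) ≤ f x + inner ℝ (gradient f x) h + L / 2 * ‖h‖ ^ 2 := by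
  rcases eq_or_ne h 0 with rfl | hh
  · simp
  have hn : ‖h‖ ≠ 0 := norm_ne_zero_iff.2 hh
  have hC1 : ContDiff ℝ 1 f := hf.1
  have htaylor := (abs_le.1 (abs_sub_taylor_le (n := 1) (contDiff_comp_line hC1 x _)
    (hf.2 x (‖h‖⁻¹ • h) (by simp [norm_smul, hn])) ‖h‖)).2
  simp only [Finset.sum_range_succ, Finset.sum_range_zero, iteratedDeriv_zero, iteratedDeriv_one,
    deriv_comp_line (hC1.differentiable (by simp)), Nat.factorial, abs_norm, Nat.reduceAdd,
    zero_smul, add_zero, smul_inv_smul₀ hn, real_inner_smul_right] at htaylor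
  norm_num at htaylor
  have hslope : ‖h‖⁻¹ * fderiv ℝ f x h * ‖h‖ = inner ℝ (gradient f x) h := by
    rw [inner_gradient_left]
    field_simp
  rw [hslope] at htaylor
  linarith

theorem HasLipschitzDeriv.penalized_add_le {L : ℝ} (hf : HasLipschitzDeriv 1 L f) (α : ℝ)
    (z x h : Vec d) :
    penalized f α z (x + h) ≤ penalized f α z x + inner ℝ (gradient (penalized f α z) x) h
      + (L + α) / 2 * ‖h‖ ^ 2 := by
  have hC1 : ContDiff ℝ 1 f := hf.1
  rw [penalized_add (hC1.differentiable (by simp))]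
  linarith [hf.add_le x h]

theorem le_lamMin_of_isMinDirection {eig : (Vec d →L[ℝ] Vec d) → Vec d}
    (heig : IsMinDirection eig) {A : Vec d →L[ℝ] Vec d} (hA : (A : Vec d →ₗ[ℝ] Vec d).IsSymmetric)
    {a : ℝ} (ha : a ≤ 0) (h : a ≤ inner ℝ (eig A) (A (eig A))) : a ≤ lamMin A :=
  le_sInf_eigenvalues ha fun s hs => h.trans (heig.le A hA s hs)

theorem apply_argmin_getD_le {ι : Type*} (l : List ι) (v : ι → ℝ) (i₀ : ι) {i : ι}
    (hi : i ∈ l) : v ((l.argmin v).getD i₀) ≤ v i := by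
  cases h : l.argmin v with
  | none => simp_all only [List.argmin_eq_none, List.not_mem_nil]
  | some j => exact List.le_of_mem_argmin hi (by simpa using h)

theorem exploitNC_le (P : Prices) (c s : Vec d) {R θ : ℝ}
    (hθ : θ ∈ [12 * R, 9 * R, -9 * R, -12 * R]) :
    f (exploitNC P f c s R).val ≤ f (c + θ • s) :=
  apply_argmin_getD_le _ (fun θ => f (c + θ • s)) 0 hθ

namespace HasLipschitzDeriv

variable {L R : ℝ}

theorem exploitNC_le_of_curvature (hf : HasLipschitzDeriv 3 L f) (P : Prices) (hL : 0 ≤ L)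
    (hR : 0 < R) {u p : Vec d} (hp : ‖p‖ = 1)
    (hcurv : inner ℝ p (hessian f u p) < -(21 * L * R ^ 2)) :
    f (exploitNC P f u p R).val ≤ f u - 500 * L * R ^ 4 := by
  have hC3 : ContDiff ℝ 3 f := hf.1
  rw [hessian, ← iteratedDeriv_two_comp_line (hC3.of_le (by norm_num))] at hcurv
  have : 0 ≤ L * R ^ 2 := by positivity
  obtain ⟨θ, hθ, hdecrease⟩ := exists_node_le_of_curvature_le hL le_rfl hR.le hR
    (contDiff_comp_line hC3 u p) (hf.2 u p hp.le) (by linarith)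
  refine (exploitNC_le P u p hθ).trans ?_
  simpa using hdecrease

theorem exploitNC_le_of_tangent (hf : HasLipschitzDeriv 3 L f) (P : Prices) (hL : 0 ≤ L)
    {z u v : Vec d} (hu : ‖u - z‖ ≤ R) (hv : ‖v - z‖ ≤ R)
    (huv : penalized f (21 * L * R ^ 2) z u < penalized f (21 * L * R ^ 2) z v
      + inner ℝ (gradient (penalized f (21 * L * R ^ 2) z) v) (u - v)) :
    f (exploitNC P f ((1 / 2 : ℝ) • (u + v)) ((1 / ‖v - u‖) • (v - u)) R).val
      ≤ f u - 500 * L * R ^ 4 := by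
  have hC3 : ContDiff ℝ 3 f := hf.1
  have hdiff : Differentiable ℝ f := hC3.differentiable (by simp)
  have hne : u ≠ v := by
    rintro rfl
    simp at huv
  have hn : 0 < ‖v - u‖ := norm_pos_iff.2 (sub_ne_zero.2 hne.symm)
  obtain ⟨hcv, hcu⟩ := midpoint_add_smul_unit hne
  set s := (1 / ‖v - u‖) • (v - u) with hs
  set c := (1 / 2 : ℝ) • (u + v)
  set h := ‖v - u‖ / 2 with hh
  have hs1 : ‖s‖ ≤ 1 := by simp [hs, norm_smul, hn.ne']
  have h0 : 0 < h := by positivity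
  have hhR : h ≤ R := by
    have := norm_sub_le (v - z) (u - z)
    rw [sub_sub_sub_cancel_right] at this
    linarith
  have hvs : u - v = -(2 * h) • s := by
    rw [← hcv, ← hcu]
    module
  have htangent : f u < f v - 2 * h * inner ℝ (gradient f v) s
      - 2 * (21 * L * R ^ 2) * h ^ 2 := by
    rw [penalized_lt_tangent_iff hdiff, norm_sub_rev, show ‖v - u‖ = 2 * h by ring, hvs,
      real_inner_smul_right] at huv
    linarith
  have hline : ContDiff ℝ 3 fun t : ℝ => f (c + t • s) := contDiff_comp_line hC3 c s
  have hcurv := curvature_le_of_tangent_gt hL h0 hhR hline (hf.2 c s hs1)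
    (by rwa [deriv_comp_line hdiff, hcv, hcu])
  obtain ⟨θ, hθ, hdecrease⟩ := exists_node_le_of_curvature_le hL h0.le hhR (h0.trans_le hhR)
    hline (hf.2 c s hs1) hcurv
  rw [hcu] at hdecrease
  exact (exploitNC_le P c s hθ).trans hdecrease

end HasLipschitzDeriv

/-! ### The cutting plane method and the certificate of nonconvexity -/

namespace Timed

variable {α β : Type}

theorem val_pure (a : α) : (pure a : Timed α).val = a := rfl

theorem time_pure (a : α) : (pure a : Timed α).time = 0 := rfl

theorem val_bind (x : Timed α) (k : α → Timed β) : (x >>= k).val = (k x.val).val := rfl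

theorem time_bind (x : Timed α) (k : α → Timed β) :
    (x >>= k).time = x.time + (k x.val).time := rfl

theorem val_charge (t : ℝ≥0) (a : α) : (charge t a).val = a := rfl

theorem time_charge (t : ℝ≥0) (a : α) : (charge t a).time = t := rfl

theorem val_ite (p : Prop) [Decidable p] (x y : Timed α) :
    (if p then x else y).val = if p then x.val else y.val := apply_ite _ _ _ _

theorem time_ite (p : Prop) [Decidable p] (x y : Timed α) :
    (if p then x else y).time = if p then x.time else y.time := apply_ite _ _ _ _

end Timed

section CuttingPlane

variable {d : ℕ} {P : Prices} {centre : Set (Vec d) → Vec d} {e : Vec d} {g : Vec d → ℝ}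
  {z : Vec d} {R : ℝ}

theorem isCompact_region {n : ℕ} (z : Vec d) (R : ℝ) (cuts : Fin n → Vec d × Vec d) :
    IsCompact (region z R cuts) := by
  refine (isCompact_closedBall z R).inter_right ?_
  simp only [Set.ofPred_forall]
  exact isClosed_iInter fun i => isClosed_le (by fun_prop) continuous_const

theorem convex_region {n : ℕ} (z : Vec d) (R : ℝ) (cuts : Fin n → Vec d × Vec d) :
    Convex ℝ (region z R cuts) := by
  refine (convex_closedBall z R).inter ?_
  simp only [Set.ofPred_forall, inner_sub_right, sub_nonpos]
  exact convex_iInter fun i => convex_halfSpace_le (innerSL ℝ (cuts i).2).isLinear _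

/-- The cuts of a list of queries, in the form in which `region` expects them. -/
noncomputable def cutData {n : ℕ} (e : Vec d) (qs : Fin n → Query d) (i : Fin n) :
    Vec d × Vec d :=
  ((qs i).point, cutNormal e (qs i))

theorem region_cutData_snoc {n : ℕ} (z : Vec d) (R : ℝ) (qs : Fin n → Query d) (q : Query d) :
    region z R (cutData e (Fin.snoc (α := fun _ => Query d) qs q)) =
      region z R (cutData e qs) ∩ cut e q := by
  ext y
  simp only [region, cutData, cut, Set.mem_inter_iff, Set.mem_ofPred_eq, Fin.forall_fin_succ',
    Fin.snoc_castSucc (α := fun _ => Query d), Fin.snoc_last (α := fun _ => Query d), and_assoc]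

theorem cuttingPlaneMethod_succ_queries (N : ℕ) :
    (cuttingPlaneMethod P centre e g z R (N + 1)).val.2 =
      Fin.snoc (α := fun _ => Query d) (cuttingPlaneMethod P centre e g z R N).val.2
        (query P g (centre (cuttingPlaneMethod P centre e g z R N).val.1)).val := rfl

theorem cuttingPlaneMethod_eq_region (N : ℕ) :
    (cuttingPlaneMethod P centre e g z R N).val.1 =
      region z R (cutData e (cuttingPlaneMethod P centre e g z R N).val.2) := by
  induction N with
  | zero =>
    change Metric.closedBall z R ∩ cut e _ = Metric.closedBall z R ∩ _
    congr 1
    ext y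
    exact ⟨fun h _ => h, fun h => h 0⟩
  | succ N ih =>
    rw [cuttingPlaneMethod_succ_queries, region_cutData_snoc, ← ih]
    rfl

theorem cuttingPlaneMethod_query (N : ℕ) (i : Fin (N + 1)) :
    (cuttingPlaneMethod P centre e g z R N).val.2 i =
      (query P g ((cuttingPlaneMethod P centre e g z R N).val.2 i).point).val := by
  induction N with
  | zero => rfl
  | succ N ih =>
    rw [cuttingPlaneMethod_succ_queries]
    refine Fin.lastCases ?_ (fun i => ?_) i
    · simp only [query, Timed.val_charge, Fin.snoc_last]
    · simpa only [Fin.snoc_castSucc] using ih i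

theorem cuttingPlaneMethod_query_zero (N : ℕ) :
    (cuttingPlaneMethod P centre e g z R N).val.2 0 = (query P g z).val := by
  induction N with
  | zero => rfl
  | succ N ih =>
    rw [cuttingPlaneMethod_succ_queries, ← ih]
    exact Fin.snoc_castSucc (α := fun _ => Query d) _ _ (0 : Fin (N + 1))

theorem cuttingPlaneMethod_time (N : ℕ) :
    (cuttingPlaneMethod P centre e g z R N).time =
      (((N + 1) * (P.T1 + 5 * P.vec d) + N * P.TC : ℝ≥0) : ℝ≥0∞) := by
  induction N with
  | zero =>
    simp [cuttingPlaneMethod, query, Timed.time_bind, Timed.time_charge, Timed.time_pure]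
  | succ N ih =>
    simp only [cuttingPlaneMethod, query, Timed.time_bind, Timed.time_charge, Timed.time_pure, ih]
    norm_cast
    push_cast
    ring

theorem point_mem_cut (q : Query d) : q.point ∈ cut e q := by simp [cut]

section CentreMem

variable (hc : ∀ S : Set (Vec d), S.Nonempty → IsCompact S → Convex ℝ S → centre S ∈ S)
include hc

theorem centre_cuttingPlaneMethod_mem {N : ℕ}
    (h : (cuttingPlaneMethod P centre e g z R N).val.1.Nonempty) :
    centre (cuttingPlaneMethod P centre e g z R N).val.1 ∈
      (cuttingPlaneMethod P centre e g z R N).val.1 := by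
  refine hc _ h ?_ ?_ <;> rw [cuttingPlaneMethod_eq_region]
  · exact isCompact_region _ _ _
  · exact convex_region _ _ _

theorem cuttingPlaneMethod_nonempty (hR : 0 ≤ R) (N : ℕ) :
    (cuttingPlaneMethod P centre e g z R N).val.1.Nonempty := by
  induction N with
  | zero => exact ⟨z, Metric.mem_closedBall_self hR, point_mem_cut (query P g z).val⟩
  | succ N ih =>
    exact ⟨_, centre_cuttingPlaneMethod_mem hc ih, point_mem_cut (query P g _).val⟩

theorem cuttingPlaneMethod_point_mem (hR : 0 ≤ R) (N : ℕ) (i : Fin (N + 1)) :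
    ((cuttingPlaneMethod P centre e g z R N).val.2 i).point ∈ Metric.closedBall z R := by
  induction N with
  | zero => exact Metric.mem_closedBall_self hR
  | succ N ih =>
    rw [cuttingPlaneMethod_succ_queries]
    refine Fin.lastCases ?_ (fun i => ?_) i
    · rw [Fin.snoc_last]
      exact ((cuttingPlaneMethod_eq_region N).subset (centre_cuttingPlaneMethod_mem hc
        (cuttingPlaneMethod_nonempty hc hR N))).1
    · simpa only [Fin.snoc_castSucc] using ih i

end CentreMem

end CuttingPlane

section Certificate

open Classical in
/-- The index of the first point outside `S`, or `0` if there is none. -/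
noncomputable def firstOutside {α : Type*} (S : Set α) (u : ℕ → α) : ℕ :=
  if h : ∃ k, u k ∉ S then Nat.find h else 0

theorem firstOutside_notMem {α : Type*} {S : Set α} {u : ℕ → α} (h : ∃ k, u k ∉ S) :
    u (firstOutside S u) ∉ S := by
  classical
  rw [firstOutside, dif_pos h]
  exact Nat.find_spec h

theorem mem_of_lt_firstOutside {α : Type*} {S : Set α} {u : ℕ → α} {k : ℕ}
    (hk : k < firstOutside S u) : u k ∈ S := by
  classical
  by_cases h : ∃ k, u k ∉ S
  · rw [firstOutside, dif_pos h] at hk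
    exact not_not.1 (Nat.find_min h hk)
  · exact not_not.1 (not_exists.1 h k)

variable {d N : ℕ}

theorem rejectionLoop_val_fst (price : ℝ≥0) (u : ℕ → Vec d) (S : Set (Vec d)) :
    (rejectionLoop price u S).val.1 = u (firstOutside S u) := by
  unfold rejectionLoop firstOutside
  split_ifs <;> rfl

theorem rejectionLoop_time {price : ℝ≥0} {u : ℕ → Vec d} {S : Set (Vec d)}
    (h : ∃ k, u k ∉ S) :
    (rejectionLoop price u S).time = (((firstOutside S u + 1) * price : ℝ≥0) : ℝ≥0∞) := by
  classical
  simp only [rejectionLoop, firstOutside, dif_pos h]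
  push_cast
  rfl

/-- The query with the smallest value. -/
noncomputable def bestQuery (qs : Fin (N + 1) → Query d) : Query d :=
  qs (((List.finRange (N + 1)).argmin fun i => (qs i).value).getD 0)

/-- The perturbed gradient step from the query `q` that belongs to the point `x` of the unit
ball. -/
noncomputable def candidate (q : Query d) (L ε : ℝ) (x : Vec d) : Vec d :=
  q.point - (1 / L) • q.slope + (ε / (8 * L)) • x

/-- The first perturbed gradient step from the best query that lies outside `S`. -/
noncomputable def firstAccepted (S : Set (Vec d)) (qs : Fin (N + 1) → Query d) (L ε : ℝ)
    (ξ : ℕ → Vec d) : Vec d :=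
  candidate (bestQuery qs) L ε (ξ (firstOutside S fun k => candidate (bestQuery qs) L ε (ξ k)))

open Classical in
/-- The first query whose tangent inequality is violated at `u`. -/
noncomputable def violatedTangent (g : Vec d → ℝ) (qs : Fin (N + 1) → Query d) (u : Vec d) :
    Option (Fin (N + 1)) :=
  (List.finRange (N + 1)).find? fun i =>
    decide (g u < (qs i).value + inner ℝ (qs i).slope (u - (qs i).point))

theorem bestQuery_value_le (qs : Fin (N + 1) → Query d) (i : Fin (N + 1)) :
    (bestQuery qs).value ≤ (qs i).value :=
  apply_argmin_getD_le _ (fun i => (qs i).value) 0 (List.mem_finRange i)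

theorem lt_tangent_of_violatedTangent {g : Vec d → ℝ} {qs : Fin (N + 1) → Query d} {u : Vec d}
    {i : Fin (N + 1)} (h : violatedTangent g qs u = some i) :
    g u < (qs i).value + inner ℝ (qs i).slope (u - (qs i).point) :=
  of_decide_eq_true (List.find?_some
    (p := fun i => decide (g u < (qs i).value + inner ℝ (qs i).slope (u - (qs i).point))) h)

theorem exists_violatedTangent_of_notMem_region {g : Vec d → ℝ} {e z u : Vec d} {R : ℝ}
    {qs : Fin (N + 1) → Query d} (hball : u ∈ Metric.closedBall z R)
    (hout : u ∉ region z R (cutData e qs)) (hbest : g u < (bestQuery qs).value) :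
    ∃ i, violatedTangent g qs u = some i := by
  classical
  obtain ⟨i, hi⟩ : ∃ i, 0 < inner ℝ (cutNormal e (qs i)) (u - (qs i).point) := by
    by_contra! hcut
    exact hout ⟨hball, hcut⟩
  have htangent : g u < (qs i).value + inner ℝ (qs i).slope (u - (qs i).point) := by
    have hvalue := hbest.trans_le (bestQuery_value_le qs i)
    by_cases hslope : (qs i).slope = 0
    · simpa [hslope] using hvalue
    · rw [cutNormal, if_neg hslope] at hi
      linarith
  rw [← Option.isSome_iff_exists, violatedTangent, List.find?_isSome]
  exact ⟨i, List.mem_finRange i, decide_eq_true htangent⟩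

variable {P : Prices} {g : Vec d → ℝ} {S : Set (Vec d)} {x₀ : Vec d}
  {qs : Fin (N + 1) → Query d} {L ε R : ℝ} {ξ : ℕ → Vec d}

theorem nonconvexityCertificate_of_slope_le (h : ‖(bestQuery qs).slope‖ ≤ ε) :
    nonconvexityCertificate P g S x₀ qs L ε R ξ =
      charge ((N + 2) * P.vec d) ((bestQuery qs).point, none, 0) := by
  have (c : Prop) [Decidable c] (a b : Timed (Vec d × Option (Vec d) × ℕ)) (hc : c) :
      (charge ((N + 2) * P.vec d) (bestQuery qs) >>= fun _ => if c then a else b) =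
        ⟨a.val, ((N + 2) * P.vec d : ℝ≥0) + a.time⟩ := by
    rw [if_pos hc]
    rfl
  refine (this _ _ _ h).trans ?_
  simp only [Timed.val_pure, Timed.time_pure, add_zero]
  rfl

theorem nonconvexityCertificate_val_of_lt_slope (h : ε < ‖(bestQuery qs).slope‖) :
    (nonconvexityCertificate P g S x₀ qs L ε R ξ).val.1 = firstAccepted S qs L ε ξ ∧
    (nonconvexityCertificate P g S x₀ qs L ε R ξ).val.2.1 =
      if ‖firstAccepted S qs L ε ξ - x₀‖ ≤ R then
        (violatedTangent g qs (firstAccepted S qs L ε ξ)).map fun i => (qs i).point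
      else none := by
  have hval : (nonconvexityCertificate P g S x₀ qs L ε R ξ).val = Timed.val _ :=
    congrArg (fun t : Timed (Vec d × Option (Vec d) × ℕ) => (t.val.1, t.val.2)) (if_neg h.not_ge)
  rw [hval]
  simp only [Timed.val_bind, Timed.val_charge, Timed.val_ite, Timed.val_pure, query,
    decide_eq_true_eq, apply_ite Prod.fst, apply_ite Prod.snd, ite_self, rejectionLoop_val_fst]
  exact ⟨rfl, rfl⟩

theorem nonconvexityCertificate_time_of_lt_slope (h : ε < ‖(bestQuery qs).slope‖)
    (hout : ∃ k, candidate (bestQuery qs) L ε (ξ k) ∉ S) :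
    (nonconvexityCertificate P g S x₀ qs L ε R ξ).time ≤
      ((P.T1 + (5 * N + 16) * P.vec d +
        (firstOutside S (fun k => candidate (bestQuery qs) L ε (ξ k)) + 1) *
          ((2 * N + 7) * P.vec d) : ℝ≥0) : ℝ≥0∞) := by
  have hloop := rejectionLoop_time (price := (3 + 2 + 2 * (N + 1)) * P.vec d) hout
  have htime : (nonconvexityCertificate P g S x₀ qs L ε R ξ).time = _ + Timed.time _ :=
    congrArg (((N + 2) * P.vec d : ℝ≥0) + Timed.time ·) (if_neg h.not_ge)
  rw [htime]
  simp only [Timed.time_bind, Timed.time_charge, Timed.time_ite, Timed.time_pure, query]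
  refine (add_le_add le_rfl (add_le_add le_rfl (add_le_add hloop.le (add_le_add le_rfl
    (?_ : _ ≤ ((P.T1 + 5 * P.vec d : ℝ≥0) : ℝ≥0∞) +
      ((4 * (N + 1) * P.vec d : ℝ≥0) : ℝ≥0∞)))))).trans (le_of_eq ?_)
  · split_ifs
    · rw [add_zero]
    · exact zero_le
  · simp only [← ENNReal.coe_add]
    congr 1
    ring

theorem nonconvexityCertificate_time_le (h : ∃ k, candidate (bestQuery qs) L ε (ξ k) ∉ S) :
    (nonconvexityCertificate P g S x₀ qs L ε R ξ).time ≤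
      ((P.T1 + (5 * N + 16) * P.vec d +
        (firstOutside S (fun k => candidate (bestQuery qs) L ε (ξ k)) + 1) *
          ((2 * N + 7) * P.vec d) : ℝ≥0) : ℝ≥0∞) := by
  rcases le_or_gt ‖(bestQuery qs).slope‖ ε with hslope | hslope
  · rw [nonconvexityCertificate_of_slope_le hslope, Timed.time_charge, ENNReal.coe_le_coe]
    have : ((N : ℝ≥0) + 2) * P.vec d ≤ (5 * N + 16) * P.vec d := by
      gcongr
      · exact le_mul_of_one_le_left zero_le (by norm_num)
      · norm_num
    exact this.trans (le_add_of_le_of_nonneg (le_add_of_nonneg_left zero_le) zero_le)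
  · exact nonconvexityCertificate_time_of_lt_slope hslope h

end Certificate

/-! ### Progress and price of a call -/

section Decrease

variable {E : Type*} [NormedAddCommGroup E] [InnerProductSpace ℝ E] [CompleteSpace E]

theorem le_sub_of_norm_gradient_penalized_le {f : E → ℝ} (hf : Differentiable ℝ f) {α ε : ℝ}
    (hα : 0 < α) (hε : 0 ≤ ε) {z u : E} (hgrad : ε ≤ ‖gradient f u‖)
    (hpen : ‖gradient (penalized f α z) u‖ ≤ ε / 2) (hu : penalized f α z u ≤ f z) :
    f u ≤ f z - ε ^ 2 / (8 * α) := by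
  rw [gradient_penalized hf] at hpen
  have hdist : ε / 2 ≤ α * ‖u - z‖ := by
    have := norm_sub_le (gradient f u + α • (u - z)) (α • (u - z))
    rw [add_sub_cancel_right, norm_smul, Real.norm_of_nonneg hα.le] at this
    linarith
  have hsq : ε ^ 2 / (8 * α) ≤ α / 2 * ‖z - u‖ ^ 2 := by
    rw [div_le_iff₀ (by positivity), norm_sub_rev]
    linarith [pow_le_pow_left₀ (by positivity) hdist 2]
  rw [penalized] at hu
  linarith

end Decrease

/-- The data of the procedure: prices, centre routine, direction of the degenerate cuts, rate of
the volume decrease, routine for the most negative curvature, objective, accuracy, Lipschitz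
constants and trust radius. -/
structure Procedure (d : ℕ) where
  P : Prices
  centre : Set (Vec d) → Vec d
  e : Vec d
  τ : ℝ
  eig : (Vec d →L[ℝ] Vec d) → Vec d
  f : Vec d → ℝ
  ε : ℝ
  L₁ : ℝ
  L₃ : ℝ
  R : ℝ

namespace Procedure

variable {d : ℕ} (A : Procedure d)

/-- The weight `α` of the penalty. -/
noncomputable def penalty : ℝ := 21 * A.L₃ * A.R ^ 2

/-- The penalized objective `f̂` around `z`. -/
noncomputable def model (z : Vec d) : Vec d → ℝ := penalized A.f A.penalty z

/-- The Lipschitz constant `L̂₁` of the gradient of the penalized objective. -/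
noncomputable def smoothness : ℝ := A.L₁ + A.penalty

/-- The number `N` of cutting plane steps of one call. -/
noncomputable def steps : ℕ := numSteps d A.τ A.smoothness A.R (A.ε / 2)

/-- The queries of the cutting plane method run around `z`. -/
noncomputable def queries (z : Vec d) : Fin (A.steps + 1) → Query d :=
  (cuttingPlaneMethod A.P A.centre A.e (A.model z) z A.R A.steps).val.2

/-- The region `S⁽ᴺ⁾` kept by the cutting plane method run around `z`. -/
noncomputable def kept (z : Vec d) : Set (Vec d) :=
  (cuttingPlaneMethod A.P A.centre A.e (A.model z) z A.R A.steps).val.1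

/-- The random point that a call at `z` draws when `x` is drawn from the unit ball. -/
noncomputable def trial (z x : Vec d) : Vec d :=
  candidate (bestQuery (A.queries z)) A.smoothness (A.ε / 2) x

/-- The number of random points that a call at `z` rejects. -/
noncomputable def rejections (z : Vec d) (ξ : ℕ → Vec d) : ℕ :=
  firstOutside (A.kept z) fun k => A.trial z (ξ k)

open Classical in
/-- The first point `u` of the certificate computed by a call at `z`. -/
noncomputable def firstPoint (z : Vec d) (ξ : ℕ → Vec d) : Vec d :=
  if ‖(bestQuery (A.queries z)).slope‖ ≤ A.ε / 2 then (bestQuery (A.queries z)).point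
  else A.trial z (ξ (A.rejections z ξ))

open Classical in
/-- The index of the query at which the second point `v` of the certificate lies. -/
noncomputable def secondQuery (z : Vec d) (ξ : ℕ → Vec d) : Option (Fin (A.steps + 1)) :=
  if ‖(bestQuery (A.queries z)).slope‖ ≤ A.ε / 2 then none
  else if ‖A.firstPoint z ξ - z‖ ≤ A.R then
    violatedTangent (A.model z) (A.queries z) (A.firstPoint z ξ)
  else none

/-- The point found on the line through `u` and `v`. -/
noncomputable def exploitPair (u v : Vec d) : Vec d :=
  (exploitNC A.P A.f ((1 / 2 : ℝ) • (u + v)) ((1 / ‖v - u‖) • (v - u)) A.R).val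

open Classical in
/-- The point returned by a call that has computed the certificate `(u, v)`. -/
noncomputable def exploit (u : Vec d) (v : Option (Vec d)) : Vec d :=
  if ‖gradient A.f u‖ ≤ A.ε then
    if -A.penalty ≤ inner ℝ (A.eig (hessian A.f u)) (hessian A.f u (A.eig (hessian A.f u))) then u
    else (exploitNC A.P A.f u (A.eig (hessian A.f u)) A.R).val
  else v.elim u (A.exploitPair u)

/-- The point returned by a call at `z`. -/
noncomputable def next (z : Vec d) (ξ : ℕ → Vec d) : Vec d :=
  A.exploit (A.firstPoint z ξ) ((A.secondQuery z ξ).map fun i => (A.queries z i).point)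

/-- A call of the trust region procedure at `z`. -/
noncomputable def call (z : Vec d) (ξ : ℕ → Vec d) : Timed (Vec d × ℕ) :=
  cuttingTrustRegion A.P A.centre A.e A.τ A.eig A.f z A.ε A.L₁ A.L₃ A.R ξ

/-- The certificate computation within a call at `z`. -/
noncomputable def certificate (z : Vec d) (ξ : ℕ → Vec d) :
    Timed (Vec d × Option (Vec d) × ℕ) :=
  nonconvexityCertificate A.P (A.model z) (A.kept z) z (A.queries z) A.smoothness (A.ε / 2) A.R ξ

theorem certificate_val (z : Vec d) (ξ : ℕ → Vec d) :
    (A.certificate z ξ).val.1 = A.firstPoint z ξ ∧ (A.certificate z ξ).val.2.1 =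
      (A.secondQuery z ξ).map fun i => (A.queries z i).point := by
  rcases le_or_gt ‖(bestQuery (A.queries z)).slope‖ (A.ε / 2) with h | h
  · rw [certificate, nonconvexityCertificate_of_slope_le h, firstPoint, secondQuery, if_pos h,
      if_pos h]
    exact ⟨rfl, rfl⟩
  · have hu : A.firstPoint z ξ = _ := if_neg h.not_ge
    obtain ⟨hfirst, hsecond⟩ := nonconvexityCertificate_val_of_lt_slope (P := A.P)
      (g := A.model z) (S := A.kept z) (x₀ := z) (R := A.R) (ξ := ξ) h
    refine ⟨hfirst.trans hu.symm, hsecond.trans ?_⟩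
    rw [secondQuery, if_neg h.not_ge, hu, apply_ite (Option.map _)]
    rfl

open Classical in
/-- The part of a call that follows the computation of the certificate `(u, v)` and of the
gradient at `u`. -/
noncomputable def timedExploit (u : Vec d) (v : Option (Vec d)) (K : ℕ) :
    Timed (Vec d × ℕ) := do
  if ‖gradient A.f u‖ ≤ A.ε then
    charge A.P.T2 ()
    charge (A.P.svd d) ()
    charge (A.P.svd d + A.P.vec d) ()
    if -A.penalty ≤ inner ℝ (A.eig (hessian A.f u)) (hessian A.f u (A.eig (hessian A.f u))) then
      return (u, K)
    else
      let zplus ← exploitNC A.P A.f u (A.eig (hessian A.f u)) A.R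
      return (zplus, K)
  else
    match v with
    | none => return (u, K)
    | some v =>
      charge (2 * A.P.vec d) ()
      charge (3 * A.P.vec d) ()
      let zplus ← exploitNC A.P A.f ((1 / 2 : ℝ) • (u + v)) ((1 / ‖v - u‖) • (v - u)) A.R
      return (zplus, K)

theorem timedExploit_val_fst (u : Vec d) (v : Option (Vec d)) (K : ℕ) :
    (A.timedExploit u v K).val.1 = A.exploit u v := by
  cases v <;>
    simp only [timedExploit, exploit, exploitPair, Timed.val_ite, Timed.val_bind, Timed.val_pure,
      apply_ite Prod.fst, Option.elim_none, Option.elim_some]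

theorem timedExploit_time_le (u : Vec d) (v : Option (Vec d)) (K : ℕ) :
    (A.timedExploit u v K).time ≤
      ((A.P.T2 + 2 * A.P.svd d + 4 * A.P.T1 + 20 * A.P.vec d : ℝ≥0) : ℝ≥0∞) := by
  have := A.P.T1.coe_nonneg
  have := A.P.T2.coe_nonneg
  have := (A.P.vec d).coe_nonneg
  have := (A.P.svd d).coe_nonneg
  cases v <;>
    simp only [timedExploit, exploitNC, Timed.time_ite, Timed.time_bind, Timed.time_charge,
      Timed.time_pure, add_zero] <;>
    split_ifs <;>
    simp only [← ENNReal.coe_add, ← ENNReal.coe_zero, ENNReal.coe_le_coe] <;>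
    rw [← NNReal.coe_le_coe] <;>
    push_cast <;>
    linarith

theorem call_eq (z : Vec d) (ξ : ℕ → Vec d) :
    A.call z ξ = charge (A.P.vec d) A.steps >>= fun N =>
      cuttingPlaneMethod A.P A.centre A.e (A.model z) z A.R N >>= fun p =>
        nonconvexityCertificate A.P (A.model z) p.1 z p.2 A.smoothness (A.ε / 2) A.R ξ >>=
          fun q => charge (A.P.T1 + A.P.vec d) (gradient A.f q.1) >>=
            fun _ => A.timedExploit q.1 q.2.1 q.2.2 := by
  unfold call cuttingTrustRegion
  refine congrArg (bind _) (funext fun N => congrArg (bind _) (funext fun p =>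
    congrArg (bind _) (funext fun q => ?_)))
  obtain ⟨u, v, K⟩ := q
  rfl

theorem call_val_fst (z : Vec d) (ξ : ℕ → Vec d) : (A.call z ξ).val.1 = A.next z ξ := by
  have : (A.call z ξ).val = (A.timedExploit (A.certificate z ξ).val.1
      (A.certificate z ξ).val.2.1 (A.certificate z ξ).val.2.2).val := by
    rw [call_eq]
    rfl
  rw [this, timedExploit_val_fst, (A.certificate_val z ξ).1, (A.certificate_val z ξ).2]
  rfl

theorem call_time_le (z : Vec d) {ξ : ℕ → Vec d} (h : ∃ k, A.trial z (ξ k) ∉ A.kept z) :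
    (A.call z ξ).time ≤ (((A.steps + 7) * (A.P.T1 + 10 * A.P.vec d) + A.steps * A.P.TC +
      A.P.T2 + 2 * A.P.svd d + (A.rejections z ξ + 1) * ((2 * A.steps + 7) * A.P.vec d) : ℝ≥0) :
        ℝ≥0∞) := by
  have htime : (A.call z ξ).time = ((A.P.vec d : ℝ≥0) : ℝ≥0∞) +
      ((cuttingPlaneMethod A.P A.centre A.e (A.model z) z A.R A.steps).time +
        ((A.certificate z ξ).time + (((A.P.T1 + A.P.vec d : ℝ≥0) : ℝ≥0∞) +
          (A.timedExploit (A.certificate z ξ).val.1 (A.certificate z ξ).val.2.1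
            (A.certificate z ξ).val.2.2).time))) := by
    rw [call_eq]
    rfl
  have hcert : (A.certificate z ξ).time ≤ ((A.P.T1 + (5 * A.steps + 16) * A.P.vec d +
      (A.rejections z ξ + 1) * ((2 * A.steps + 7) * A.P.vec d) : ℝ≥0) : ℝ≥0∞) :=
    nonconvexityCertificate_time_le h
  rw [htime, cuttingPlaneMethod_time]
  refine (add_le_add le_rfl (add_le_add le_rfl
    (add_le_add hcert (add_le_add le_rfl (A.timedExploit_time_le _ _ _))))).trans ?_
  simp only [← ENNReal.coe_add, ENNReal.coe_le_coe]
  rw [← NNReal.coe_le_coe]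
  push_cast
  linarith [(A.P.vec d).coe_nonneg]

/-- The assumptions of the theorem on the data of the procedure. -/
structure Valid (A : Procedure d) : Prop where
  dim_pos : 0 < d
  cutting : CuttingPlaneAssumption A.P A.centre A.e A.τ
  minDir : IsMinDirection A.eig
  L₁_pos : 0 < A.L₁
  L₃_pos : 0 < A.L₃
  ε_pos : 0 < A.ε
  R_pos : 0 < A.R
  lip₁ : HasLipschitzDeriv 1 A.L₁ A.f
  lip₃ : HasLipschitzDeriv 3 A.L₃ A.f

theorem queries_value (z : Vec d) (i : Fin (A.steps + 1)) :
    (A.queries z i).value = A.model z (A.queries z i).point :=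
  congrArg Query.value (cuttingPlaneMethod_query A.steps i)

theorem queries_slope (z : Vec d) (i : Fin (A.steps + 1)) :
    (A.queries z i).slope = gradient (A.model z) (A.queries z i).point :=
  congrArg Query.slope (cuttingPlaneMethod_query A.steps i)

theorem bestQuery_value (z : Vec d) : (bestQuery (A.queries z)).value =
    A.model z (bestQuery (A.queries z)).point := A.queries_value z _

theorem bestQuery_slope (z : Vec d) : (bestQuery (A.queries z)).slope =
    gradient (A.model z) (bestQuery (A.queries z)).point := A.queries_slope z _

theorem bestQuery_value_le_self (z : Vec d) : (bestQuery (A.queries z)).value ≤ A.f z := by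
  refine (bestQuery_value_le (A.queries z) 0).trans_eq ?_
  have hzero : A.queries z 0 = (query A.P (A.model z) z).val := cuttingPlaneMethod_query_zero _
  rw [hzero]
  exact penalized_self A.f A.penalty z

theorem trial_rejections_notMem_kept {z : Vec d} {ξ : ℕ → Vec d}
    (h : ∃ k, A.trial z (ξ k) ∉ A.kept z) : A.trial z (ξ (A.rejections z ξ)) ∉ A.kept z :=
  firstOutside_notMem (u := fun k => A.trial z (ξ k)) h

theorem lt_tangent_of_secondQuery {z : Vec d} {ξ : ℕ → Vec d} {i : Fin (A.steps + 1)}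
    (h : A.secondQuery z ξ = some i) : ‖A.firstPoint z ξ - z‖ ≤ A.R ∧
      A.model z (A.firstPoint z ξ) < A.model z (A.queries z i).point +
        inner ℝ (gradient (A.model z) (A.queries z i).point)
          (A.firstPoint z ξ - (A.queries z i).point) := by
  unfold secondQuery at h
  split_ifs at h with _ hball
  have htangent := lt_tangent_of_violatedTangent h
  rw [queries_slope, queries_value] at htangent
  exact ⟨hball, htangent⟩

/-- The decrease of the objective that a call guarantees. -/
noncomputable def decrease : ℝ := min (A.ε ^ 2 / (8 * A.penalty)) (10 * A.L₃ * A.R ^ 4)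

namespace Valid

variable {A} (hA : A.Valid)
include hA

theorem penalty_pos : 0 < A.penalty := by
  have := hA.L₃_pos
  have := hA.R_pos
  unfold penalty
  positivity

theorem smoothness_pos : 0 < A.smoothness := add_pos hA.L₁_pos hA.penalty_pos

theorem decrease_pos : 0 < A.decrease := by
  have := hA.penalty_pos
  have := hA.ε_pos
  have := hA.L₃_pos
  have := hA.R_pos
  exact lt_min (by positivity) (by positivity)

theorem contDiff : ContDiff ℝ 3 A.f := hA.lip₃.1

theorem contDiff_two : ContDiff ℝ 2 A.f := hA.contDiff.of_le (by norm_num)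

theorem differentiable : Differentiable ℝ A.f := hA.contDiff.differentiable (by norm_num)

theorem queries_point_mem (z : Vec d) (i : Fin (A.steps + 1)) :
    ‖(A.queries z i).point - z‖ ≤ A.R := by
  rw [← mem_closedBall_iff_norm]
  exact cuttingPlaneMethod_point_mem hA.cutting.centre_mem hA.R_pos.le _ _

theorem model_trial_lt {z x : Vec d} (h : A.ε / 2 < ‖(bestQuery (A.queries z)).slope‖)
    (hx : ‖x‖ ≤ 1) : A.model z (A.trial z x) < (bestQuery (A.queries z)).value := by
  rw [bestQuery_value]
  refine perturbed_gradient_step_lt hA.smoothness_pos (fun y => ?_) (half_pos hA.ε_pos) h hx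
  rw [bestQuery_slope]
  exact hA.lip₁.penalized_add_le A.penalty z _ y

theorem model_firstPoint_le (z : Vec d) {ξ : ℕ → Vec d} (hξ : ∀ k, ‖ξ k‖ ≤ 1) :
    A.model z (A.firstPoint z ξ) ≤ A.f z := by
  refine le_trans ?_ (A.bestQuery_value_le_self z)
  unfold firstPoint
  split_ifs with h
  · exact (A.bestQuery_value z).ge
  · exact (hA.model_trial_lt (not_le.1 h) (hξ _)).le

theorem f_firstPoint_le (z : Vec d) {ξ : ℕ → Vec d} (hξ : ∀ k, ‖ξ k‖ ≤ 1) :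
    A.f (A.firstPoint z ξ) ≤ A.f z :=
  (le_penalized A.f hA.penalty_pos.le z _).trans (hA.model_firstPoint_le z hξ)

theorem gradient_le_or_lt_norm_of_secondQuery_eq_none {z : Vec d} {ξ : ℕ → Vec d}
    (hξ : ∀ k, ‖ξ k‖ ≤ 1) (hout : ∃ k, A.trial z (ξ k) ∉ A.kept z)
    (h : A.secondQuery z ξ = none) :
    ‖gradient (A.model z) (A.firstPoint z ξ)‖ ≤ A.ε / 2 ∨ A.R < ‖A.firstPoint z ξ - z‖ := by
  by_contra! hfirst
  have hslope : ¬‖(bestQuery (A.queries z)).slope‖ ≤ A.ε / 2 := by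
    intro hle
    rw [firstPoint, if_pos hle, ← bestQuery_slope] at hfirst
    exact hfirst.1.not_ge hle
  have hu : A.firstPoint z ξ = A.trial z (ξ (A.rejections z ξ)) := if_neg hslope
  rw [secondQuery, if_neg hslope, if_pos hfirst.2] at h
  have hnotMem := A.trial_rejections_notMem_kept hout
  rw [kept, cuttingPlaneMethod_eq_region, ← hu] at hnotMem
  obtain ⟨i, hi⟩ := exists_violatedTangent_of_notMem_region (g := A.model z)
    (mem_closedBall_iff_norm.2 hfirst.2) hnotMem
    (hu ▸ hA.model_trial_lt (not_le.1 hslope) (hξ _))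
  exact Option.some_ne_none i (hi.symm.trans h)

theorem f_firstPoint_le_of_secondQuery_eq_none {z : Vec d} {ξ : ℕ → Vec d}
    (hξ : ∀ k, ‖ξ k‖ ≤ 1) (hout : ∃ k, A.trial z (ξ k) ∉ A.kept z)
    (h : A.secondQuery z ξ = none) (hgrad : A.ε < ‖gradient A.f (A.firstPoint z ξ)‖) :
    A.f (A.firstPoint z ξ) ≤ A.f z - A.decrease := by
  have hmodel := hA.model_firstPoint_le z hξ
  rcases hA.gradient_le_or_lt_norm_of_secondQuery_eq_none hξ hout h with hpen | hfar
  · have := le_sub_of_norm_gradient_penalized_le hA.differentiable hA.penalty_pos hA.ε_pos.le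
      hgrad.le hpen hmodel
    exact this.trans (sub_le_sub_left (min_le_left _ _) _)
  · refine le_trans ?_ (sub_le_sub_left (min_le_right _ _) _)
    have hsq : A.penalty / 2 * A.R ^ 2 ≤ A.penalty / 2 * ‖z - A.firstPoint z ξ‖ ^ 2 := by
      rw [norm_sub_rev]
      have := hA.penalty_pos
      have := hA.R_pos
      gcongr
    have hLR : 0 < A.L₃ * A.R ^ 4 := mul_pos hA.L₃_pos (pow_pos hA.R_pos 4)
    simp only [model, penalized] at hmodel
    have hpen : A.penalty / 2 * A.R ^ 2 = 21 / 2 * (A.L₃ * A.R ^ 4) := by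
      unfold penalty
      ring
    linarith

theorem sub_le_sub_decrease {x : ℝ} {z : Vec d} {ξ : ℕ → Vec d} (hξ : ∀ k, ‖ξ k‖ ≤ 1)
    (hx : x ≤ A.f (A.firstPoint z ξ) - 500 * A.L₃ * A.R ^ 4) : x ≤ A.f z - A.decrease := by
  have := hA.f_firstPoint_le z hξ
  have : 0 < A.L₃ * A.R ^ 4 := mul_pos hA.L₃_pos (pow_pos hA.R_pos 4)
  have : A.decrease ≤ 10 * A.L₃ * A.R ^ 4 := min_le_right _ _
  linarith

theorem isApproxStationary_or_f_next_le {z : Vec d} {ξ : ℕ → Vec d} (hξ : ∀ k, ‖ξ k‖ ≤ 1)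
    (hout : ∃ k, A.trial z (ξ k) ∉ A.kept z) :
    IsApproxStationary A.f A.ε A.penalty (A.next z ξ) ∨
      A.f (A.next z ξ) ≤ A.f z - A.decrease := by
  rw [next, exploit]
  split_ifs with hgrad hcurv
  · refine Or.inl ⟨hgrad, ?_⟩
    exact le_lamMin_of_isMinDirection hA.minDir
      (isSymmetric_fderiv_gradient hA.contDiff_two _) (neg_nonpos.2 hA.penalty_pos.le) hcurv
  · refine Or.inr (hA.sub_le_sub_decrease hξ ?_)
    exact hA.lip₃.exploitNC_le_of_curvature A.P hA.L₃_pos.le hA.R_pos (hA.minDir.norm_eq _)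
      (not_le.1 hcurv)
  · refine Or.inr ?_
    cases hsecond : A.secondQuery z ξ with
    | none => exact hA.f_firstPoint_le_of_secondQuery_eq_none hξ hout hsecond (not_le.1 hgrad)
    | some i =>
      obtain ⟨hball, htangent⟩ := A.lt_tangent_of_secondQuery hsecond
      exact hA.sub_le_sub_decrease hξ (hA.lip₃.exploitNC_le_of_tangent A.P hA.L₃_pos.le hball
        (hA.queries_point_mem z i) htangent)

end Valid

end Procedure

/-! ### Measurability of a call -/

section Selection

variable {X Y ι : Type*} [MeasurableSpace X] [MeasurableSpace Y]

theorem measurable_argmin_elim (l : List ι) {v : X → ι → ℝ} (hv : ∀ i, Measurable fun x => v x i)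
    {h : ι → X → Y} (hh : ∀ i, Measurable (h i)) {h₀ : X → Y} (hh₀ : Measurable h₀) :
    Measurable fun x => (l.argmin (v x)).elim (h₀ x) fun i => h i x := by
  induction l generalizing h h₀ with
  | nil => exact hh₀
  | cons a l ih =>
    have := ih (h := fun c x => if v x c < v x a then h c x else h a x) (h₀ := h a)
      (fun c => Measurable.ite (measurableSet_lt (hv c) (hv a)) (hh c) (hh a)) (hh a)
    convert this using 2 with x
    rw [List.argmin_cons]
    cases List.argmin (v x) l with
    | none => rfl
    | some c =>
      dsimp only [Option.elim]
      split_ifs <;> rfl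

theorem measurable_argmin_getD (l : List ι) (i₀ : ι) {v : X → ι → ℝ}
    (hv : ∀ i, Measurable fun x => v x i) {h : ι → X → Y} (hh : ∀ i, Measurable (h i)) :
    Measurable fun x => h ((l.argmin (v x)).getD i₀) x := by
  convert measurable_argmin_elim l hv hh (hh i₀) using 2 with x
  cases List.argmin (v x) l <;> rfl

open Classical in
theorem measurable_find?_elim (l : List ι) {p : X → ι → Prop}
    (hp : ∀ i, MeasurableSet {x | p x i}) {h : ι → X → Y} (hh : ∀ i, Measurable (h i)) {h₀ : X → Y}
    (hh₀ : Measurable h₀) :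
    Measurable fun x => (l.find? fun i => decide (p x i)).elim (h₀ x) fun i => h i x := by
  induction l with
  | nil => exact hh₀
  | cons a l ih =>
    have hcons : Measurable fun x => if p x a then h a x
        else (l.find? fun i => decide (p x i)).elim (h₀ x) fun i => h i x :=
      Measurable.ite (hp a) (hh a) ih
    convert hcons using 2 with x
    by_cases hx : p x a <;> simp [hx]

omit [MeasurableSpace Y] in
theorem measurable_firstOutside {S : X → Set Y} {u : X → ℕ → Y}
    (h : ∀ k, MeasurableSet {x | u x k ∈ S x}) :
    Measurable fun x => firstOutside (S x) (u x) := by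
  classical
  have hex (x : X) : ∃ k, u x k ∉ S x ∨ ∀ j, u x j ∈ S x := by
    by_cases hx : ∃ k, u x k ∉ S x
    · exact hx.imp fun _ => Or.inl
    · exact ⟨0, Or.inr fun j => not_not.1 (not_exists.1 hx j)⟩
  have heq (x : X) : firstOutside (S x) (u x) = Nat.find (hex x) := by
    by_cases hx : ∃ k, u x k ∉ S x
    · obtain ⟨k, hk⟩ := hx
      have hall : ¬ ∀ j, u x j ∈ S x := fun hall => hk (hall k)
      simp only [firstOutside, hall, or_false, dif_pos (⟨k, hk⟩ : ∃ k, u x k ∉ S x)]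
    · rw [firstOutside, dif_neg hx, eq_comm, Nat.find_eq_zero]
      exact Or.inr fun j => not_not.1 (not_exists.1 hx j)
  simp_rw [heq]
  refine measurable_find hex fun k => (h k).compl.union ?_
  have hall : {x | ∀ j, u x j ∈ S x} = ⋂ j, {x | u x j ∈ S x} :=
    Set.ofPred_forall fun j x => u x j ∈ S x
  exact (MeasurableSet.iInter h).congr hall.symm

end Selection

section Queries

variable {X : Type*} [MeasurableSpace X] {d n : ℕ}

theorem measurable_cutData (e : Vec d) {qs : X → Fin n → Query d}
    (hpoint : ∀ i, Measurable fun x => (qs x i).point)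
    (hslope : ∀ i, Measurable fun x => (qs x i).slope) :
    Measurable fun x => cutData e (qs x) := by
  classical
  refine measurable_pi_lambda _ fun i => (hpoint i).prodMk ?_
  exact Measurable.ite (hslope i (measurableSet_singleton 0)) measurable_const (hslope i)

theorem measurable_snoc_point {qs : X → Fin n → Query d} {q : X → Query d}
    (hqs : ∀ i, Measurable fun x => (qs x i).point) (hq : Measurable fun x => (q x).point)
    (i : Fin (n + 1)) :
    Measurable fun x => (Fin.snoc (α := fun _ => Query d) (qs x) (q x) i).point := by
  refine Fin.lastCases ?_ (fun i => ?_) i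
  · simpa only [Fin.snoc_last] using hq
  · simpa only [Fin.snoc_castSucc] using hqs i

theorem measurableSet_mem_region {z y : X → Vec d} (hz : Measurable z) (hy : Measurable y) (R : ℝ)
    {cuts : X → Fin n → Vec d × Vec d} (hcuts : Measurable cuts) :
    MeasurableSet {x | y x ∈ region (z x) R (cuts x)} := by
  have hball : MeasurableSet {x | dist (y x) (z x) ≤ R} :=
    measurableSet_le (hy.dist hz) measurable_const
  have hcut (i : Fin n) : MeasurableSet {x | inner ℝ (cuts x i).2 (y x - (cuts x i).1) ≤ 0} := by
    have hi := (measurable_pi_apply i).comp hcuts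
    exact measurableSet_le (hi.snd.inner (hy.sub hi.fst)) measurable_const
  convert hball.inter (MeasurableSet.iInter hcut) using 1
  ext x
  simp only [region, Set.mem_inter_iff, Metric.mem_closedBall, Set.mem_ofPred_eq, Set.mem_iInter]

end Queries

namespace Procedure.Valid

variable {d : ℕ} {A : Procedure d} (hA : A.Valid)
include hA

theorem measurable_f : Measurable A.f := hA.contDiff.continuous.measurable

theorem measurable_gradient : Measurable (gradient A.f) :=
  (contDiff_gradient (m := 1) hA.contDiff_two le_rfl).continuous.measurable

section Model

variable {X : Type*} [MeasurableSpace X] {z x : X → Vec d}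

theorem measurable_model (hz : Measurable z) (hx : Measurable x) :
    Measurable fun a => A.model (z a) (x a) := by
  have := hA.measurable_f.comp hx
  unfold model penalized
  fun_prop

theorem measurable_gradient_model (hz : Measurable z) (hx : Measurable x) :
    Measurable fun a => gradient (A.model (z a)) (x a) := by
  simp only [model, gradient_penalized hA.differentiable]
  have := hA.measurable_gradient.comp hx
  fun_prop

end Model

theorem measurable_cuttingPlaneMethod_point (N : ℕ) (i : Fin (N + 1)) :
    Measurable fun z =>
      ((cuttingPlaneMethod A.P A.centre A.e (A.model z) z A.R N).val.2 i).point := by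
  induction N with
  | zero => exact measurable_id
  | succ N ih =>
    have hslope (i : Fin (N + 1)) : Measurable fun z =>
        ((cuttingPlaneMethod A.P A.centre A.e (A.model z) z A.R N).val.2 i).slope := by
      simp only [fun z => congrArg Query.slope (cuttingPlaneMethod_query (P := A.P)
        (centre := A.centre) (e := A.e) (g := A.model z) (z := z) (R := A.R) N i)]
      exact hA.measurable_gradient_model measurable_id (ih i)
    have hcentre : Measurable fun z =>
        A.centre (cuttingPlaneMethod A.P A.centre A.e (A.model z) z A.R N).val.1 := by
      simp only [cuttingPlaneMethod_eq_region]
      exact (hA.cutting.measurable_centre (N + 1) A.R).comp (f := fun z : Vec d => (z, cutData A.e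
          (cuttingPlaneMethod A.P A.centre A.e (A.model z) z A.R N).val.2))
        (measurable_id.prodMk (measurable_cutData A.e ih hslope))
    exact measurable_snoc_point ih hcentre i

theorem measurable_queries_point (i : Fin (A.steps + 1)) :
    Measurable fun z => (A.queries z i).point :=
  hA.measurable_cuttingPlaneMethod_point A.steps i

theorem measurable_queries_value (i : Fin (A.steps + 1)) :
    Measurable fun z => (A.queries z i).value := by
  simp_rw [queries_value]
  exact hA.measurable_model measurable_id (hA.measurable_queries_point i)

theorem measurable_queries_slope (i : Fin (A.steps + 1)) :
    Measurable fun z => (A.queries z i).slope := by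
  simp_rw [queries_slope]
  exact hA.measurable_gradient_model measurable_id (hA.measurable_queries_point i)

theorem measurable_bestQuery_point : Measurable fun z => (bestQuery (A.queries z)).point :=
  measurable_argmin_getD (List.finRange (A.steps + 1)) 0 hA.measurable_queries_value
    hA.measurable_queries_point

theorem measurable_bestQuery_slope : Measurable fun z => (bestQuery (A.queries z)).slope :=
  measurable_argmin_getD (List.finRange (A.steps + 1)) 0 hA.measurable_queries_value
    hA.measurable_queries_slope

theorem measurable_trial : Measurable fun p : Vec d × Vec d => A.trial p.1 p.2 := by
  have hpoint : Measurable fun p : Vec d × Vec d => (bestQuery (A.queries p.1)).point :=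
    hA.measurable_bestQuery_point.comp measurable_fst
  have hslope : Measurable fun p : Vec d × Vec d => (bestQuery (A.queries p.1)).slope :=
    hA.measurable_bestQuery_slope.comp measurable_fst
  unfold trial candidate
  fun_prop

theorem measurableSet_trial_mem_kept :
    MeasurableSet {p : Vec d × Vec d | A.trial p.1 p.2 ∈ A.kept p.1} := by
  simp only [kept, cuttingPlaneMethod_eq_region]
  exact measurableSet_mem_region measurable_fst hA.measurable_trial A.R
    ((measurable_cutData A.e hA.measurable_queries_point hA.measurable_queries_slope).comp
      measurable_fst)

theorem measurable_rejections :
    Measurable fun p : Vec d × (ℕ → Vec d) => A.rejections p.1 p.2 :=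
  measurable_firstOutside fun k => measurableSet_preimage
    (f := fun p : Vec d × (ℕ → Vec d) => (p.1, p.2 k)) (by fun_prop)
    hA.measurableSet_trial_mem_kept

theorem measurable_firstPoint :
    Measurable fun p : Vec d × (ℕ → Vec d) => A.firstPoint p.1 p.2 := by
  refine Measurable.ite (measurableSet_le ?_ measurable_const) ?_ ?_
  · exact (hA.measurable_bestQuery_slope.comp measurable_fst).norm
  · exact hA.measurable_bestQuery_point.comp measurable_fst
  · have htrial (k : ℕ) : Measurable fun p : Vec d × (ℕ → Vec d) => A.trial p.1 (p.2 k) :=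
      hA.measurable_trial.comp (f := fun p : Vec d × (ℕ → Vec d) => (p.1, p.2 k)) (by fun_prop)
    have hselect : Measurable fun q : (Vec d × (ℕ → Vec d)) × ℕ => A.trial q.1.1 (q.1.2 q.2) :=
      measurable_from_prod_countable_left
        (f := fun q : (Vec d × (ℕ → Vec d)) × ℕ => A.trial q.1.1 (q.1.2 q.2)) htrial
    have hindex : Measurable fun p : Vec d × (ℕ → Vec d) => (p, A.rejections p.1 p.2) :=
      measurable_id.prodMk hA.measurable_rejections
    exact hselect.comp (f := fun p : Vec d × (ℕ → Vec d) => (p, A.rejections p.1 p.2)) hindex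

theorem measurable_exploitNC :
    Measurable fun p : Vec d × Vec d => (exploitNC A.P A.f p.1 p.2 A.R).val :=
  measurable_argmin_getD [12 * A.R, 9 * A.R, -9 * A.R, -12 * A.R] 0
    (v := fun (p : Vec d × Vec d) θ => A.f (p.1 + θ • p.2))
    (fun θ => hA.measurable_f.comp (by fun_prop)) (h := fun θ p => p.1 + θ • p.2)
    (fun θ => by fun_prop)

theorem measurable_exploitPair : Measurable fun p : Vec d × Vec d => A.exploitPair p.1 p.2 :=
  hA.measurable_exploitNC.comp (f := fun p : Vec d × Vec d =>
    ((1 / 2 : ℝ) • (p.1 + p.2), (1 / ‖p.2 - p.1‖) • (p.2 - p.1))) (by fun_prop)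

theorem measurable_direction : Measurable fun u => A.eig (hessian A.f u) :=
  hA.minDir.measurable.comp (continuous_hessian hA.contDiff_two).measurable

theorem measurable_curvature :
    Measurable fun u =>
      inner ℝ (A.eig (hessian A.f u)) (hessian A.f u (A.eig (hessian A.f u))) := by
  have h : Continuous fun p : Vec d × Vec d => (inner ℝ p.2 (hessian A.f p.1 p.2) : ℝ) :=
    continuous_snd.inner (((continuous_hessian hA.contDiff_two).comp continuous_fst).clm_apply
      continuous_snd)
  exact h.measurable.comp (f := fun u => (u, A.eig (hessian A.f u)))
    (measurable_id.prodMk hA.measurable_direction)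

theorem measurable_violatedTangent_elim {h : Fin (A.steps + 1) → Vec d × (ℕ → Vec d) → Vec d}
    (hh : ∀ i, Measurable (h i)) {h₀ : Vec d × (ℕ → Vec d) → Vec d} (hh₀ : Measurable h₀) :
    Measurable fun p : Vec d × (ℕ → Vec d) =>
      (violatedTangent (A.model p.1) (A.queries p.1) (A.firstPoint p.1 p.2)).elim (h₀ p)
        fun i => h i p := by
  refine measurable_find?_elim _ (fun i => measurableSet_lt ?_ ?_) hh hh₀
  · exact hA.measurable_model measurable_fst hA.measurable_firstPoint
  · exact ((hA.measurable_queries_value i).comp measurable_fst).add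
      (((hA.measurable_queries_slope i).comp measurable_fst).inner
        (hA.measurable_firstPoint.sub ((hA.measurable_queries_point i).comp measurable_fst)))

theorem measurable_secondQuery_elim {h : Fin (A.steps + 1) → Vec d × (ℕ → Vec d) → Vec d}
    (hh : ∀ i, Measurable (h i)) {h₀ : Vec d × (ℕ → Vec d) → Vec d} (hh₀ : Measurable h₀) :
    Measurable fun p : Vec d × (ℕ → Vec d) =>
      (A.secondQuery p.1 p.2).elim (h₀ p) fun i => h i p := by
  classical
  have hslope : MeasurableSet {p : Vec d × (ℕ → Vec d) |
      ‖(bestQuery (A.queries p.1)).slope‖ ≤ A.ε / 2} :=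
    measurableSet_le (hA.measurable_bestQuery_slope.comp measurable_fst).norm measurable_const
  have hball : MeasurableSet {p : Vec d × (ℕ → Vec d) | ‖A.firstPoint p.1 p.2 - p.1‖ ≤ A.R} :=
    measurableSet_le (hA.measurable_firstPoint.sub measurable_fst).norm measurable_const
  have hite : Measurable fun p : Vec d × (ℕ → Vec d) =>
      if ‖(bestQuery (A.queries p.1)).slope‖ ≤ A.ε / 2 then h₀ p
      else if ‖A.firstPoint p.1 p.2 - p.1‖ ≤ A.R then
        (violatedTangent (A.model p.1) (A.queries p.1) (A.firstPoint p.1 p.2)).elim (h₀ p)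
          fun i => h i p
      else h₀ p :=
    Measurable.ite hslope hh₀
      (Measurable.ite hball (hA.measurable_violatedTangent_elim hh hh₀) hh₀)
  convert hite using 2 with p
  unfold secondQuery
  split_ifs <;> rfl

theorem measurable_next : Measurable fun p : Vec d × (ℕ → Vec d) => A.next p.1 p.2 := by
  classical
  have hu := hA.measurable_firstPoint
  have hpair (i : Fin (A.steps + 1)) : Measurable fun p : Vec d × (ℕ → Vec d) =>
      A.exploitPair (A.firstPoint p.1 p.2) (A.queries p.1 i).point :=
    hA.measurable_exploitPair.comp (f := fun p : Vec d × (ℕ → Vec d) =>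
      (A.firstPoint p.1 p.2, (A.queries p.1 i).point))
      (hu.prodMk ((hA.measurable_queries_point i).comp measurable_fst))
  refine Measurable.ite (measurableSet_le (hA.measurable_gradient.comp hu).norm measurable_const)
    (Measurable.ite (measurableSet_le measurable_const (hA.measurable_curvature.comp hu)) hu
      (hA.measurable_exploitNC.comp (f := fun p : Vec d × (ℕ → Vec d) =>
        (A.firstPoint p.1 p.2, A.eig (hessian A.f (A.firstPoint p.1 p.2))))
          (hu.prodMk (hA.measurable_direction.comp hu)))) ?_
  convert hA.measurable_secondQuery_elim hpair hu using 2 with p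
  cases A.secondQuery p.1 p.2 <;> rfl

end Procedure.Valid

/-! ### Rejection sampling along a random orbit -/

section Rejection

variable {E : Type*}

/-- A weight that dominates the exponential of a tenth of the number of points `x 0, x 1, …` to
be drawn until one lies outside `B`; it is infinite if all of them lie in `B`. -/
noncomputable def rejectionWeight (B : Set E) (x : ℕ → E) : ℝ≥0∞ :=
  ∑' k : ℕ, ENNReal.ofReal (Real.exp ((k + 1) / 10)) * ∏ j ∈ Finset.range k, B.indicator 1 (x j)

variable {B : Set E} {x : ℕ → E}

theorem exp_le_rejectionWeight {k : ℕ} (h : ∀ j < k, x j ∈ B) :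
    ENNReal.ofReal (Real.exp ((k + 1) / 10)) ≤ rejectionWeight B x := by
  have hprod : ∏ j ∈ Finset.range k, B.indicator (1 : E → ℝ≥0∞) (x j) = 1 :=
    Finset.prod_eq_one fun j hj => Set.indicator_of_mem (h j (Finset.mem_range.1 hj)) _
  simpa only [rejectionWeight, hprod, mul_one] using ENNReal.le_tsum (f := fun k : ℕ =>
    ENNReal.ofReal (Real.exp ((k + 1) / 10)) * ∏ j ∈ Finset.range k, B.indicator 1 (x j)) k

theorem one_le_rejectionWeight : 1 ≤ rejectionWeight B x :=
  (ENNReal.one_le_ofReal.2 (Real.one_le_exp (by positivity))).trans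
    (exp_le_rejectionWeight (k := 0) (by simp))

theorem exists_notMem_of_rejectionWeight_ne_top (h : rejectionWeight B x ≠ ⊤) :
    ∃ k, x k ∉ B := by
  by_contra! hall
  refine h (ENNReal.eq_top_of_forall_nnreal_le fun r => ?_)
  obtain ⟨k, hk⟩ := exists_nat_ge (10 * (r : ℝ))
  refine le_trans ?_ (exp_le_rejectionWeight (k := k) fun j _ => hall j)
  rw [ENNReal.le_ofReal_iff_toReal_le ENNReal.coe_ne_top (Real.exp_pos _).le, ENNReal.coe_toReal]
  linarith [Real.add_one_le_exp (((k : ℝ) + 1) / 10)]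

theorem exp_one_tenth_le : Real.exp (1 / 10) ≤ 5 / 4 := by
  have h := Real.one_sub_le_exp_neg (1 / 10)
  rw [Real.exp_neg, le_inv_comm₀ (by norm_num) (Real.exp_pos _)] at h
  exact h.trans (by norm_num)

theorem exp_mul_half_pow_le (k : ℕ) :
    Real.exp ((k + 1) / 10) * (1 / 2) ^ k ≤ 5 / 4 * (5 / 8) ^ k :=
  calc Real.exp ((k + 1) / 10) * (1 / 2) ^ k
      = Real.exp (1 / 10) ^ (k + 1) * (1 / 2) ^ k := by
        rw [← Real.exp_nat_mul]
        push_cast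
        ring_nf
    _ ≤ (5 / 4) ^ (k + 1) * (1 / 2) ^ k := by
        gcongr
        exact exp_one_tenth_le
    _ = 5 / 4 * (5 / 8) ^ k := by
        rw [pow_succ', mul_assoc, ← mul_pow]
        norm_num

theorem tsum_exp_mul_half_pow_le :
    ∑' k : ℕ, ENNReal.ofReal (Real.exp ((k + 1) / 10)) * ENNReal.ofReal (1 / 2) ^ k ≤ 4 := by
  have hsum : Summable fun k : ℕ => (5 / 4 : ℝ) * (5 / 8) ^ k :=
    (summable_geometric_of_lt_one (by norm_num) (by norm_num)).mul_left _
  calc ∑' k : ℕ, ENNReal.ofReal (Real.exp ((k + 1) / 10)) * ENNReal.ofReal (1 / 2) ^ k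
      ≤ ∑' k : ℕ, ENNReal.ofReal (5 / 4 * (5 / 8) ^ k) := by
        refine ENNReal.tsum_le_tsum fun k => ?_
        rw [← ENNReal.ofReal_pow (by norm_num), ← ENNReal.ofReal_mul (Real.exp_pos _).le]
        exact ENNReal.ofReal_le_ofReal (exp_mul_half_pow_le k)
    _ = ENNReal.ofReal (5 / 4 * (1 - 5 / 8)⁻¹) := by
        rw [← ENNReal.ofReal_tsum_of_nonneg (fun k => by positivity) hsum, tsum_mul_left,
          tsum_geometric_of_lt_one (by norm_num) (by norm_num)]
    _ ≤ 4 := ENNReal.ofReal_le_of_le_toReal (by norm_num)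

theorem prod_indicator_one_eq {Ω : Type*} (X : ℕ → Ω → E) (B : Set E) (k : ℕ) (w : Ω) :
    ∏ j ∈ Finset.range k, B.indicator (1 : E → ℝ≥0∞) (X j w) =
      (⋂ j ∈ Finset.range k, X j ⁻¹' B).indicator 1 w := by
  classical
  simp only [Set.indicator_apply, Pi.one_apply, Finset.prod_ite_zero, Finset.prod_const_one,
    Set.mem_iInter, Set.mem_preimage]

theorem lintegral_rejectionWeight_le [MeasurableSpace E] {Ω : Type*} [MeasurableSpace Ω]
    {μ : Measure Ω} {X : ℕ → Ω → E} (hX : ∀ k, Measurable (X k)) (hind : iIndepFun X μ)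
    (hB : MeasurableSet B) (hhalf : ∀ k, μ (X k ⁻¹' B) ≤ ENNReal.ofReal (1 / 2)) :
    ∫⁻ w, rejectionWeight B (fun k => X k w) ∂μ ≤ 4 := by
  have hm (k : ℕ) : MeasurableSet (⋂ j ∈ Finset.range k, X j ⁻¹' B) :=
    Finset.measurableSet_biInter _ fun j _ => hX j hB
  simp only [rejectionWeight, prod_indicator_one_eq]
  rw [lintegral_tsum fun k => ((measurable_one.indicator (hm k)).const_mul _).aemeasurable]
  refine (ENNReal.tsum_le_tsum fun k => ?_).trans tsum_exp_mul_half_pow_le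
  rw [lintegral_const_mul _ (measurable_one.indicator (hm k)), lintegral_indicator_one (hm k),
    hind.measure_inter_preimage_eq_mul (Finset.range k) fun _ _ => hB]
  gcongr
  refine (Finset.prod_le_pow_card _ _ _ fun j _ => hhalf j).trans ?_
  rw [Finset.card_range]

end Rejection

section Independence

variable {Ω E : Type*} [MeasurableSpace Ω] [MeasurableSpace E] {μ : Measure Ω}

theorem iIndepFun_curry {ι κ : Type*} {X : ι → κ → Ω → E} (hX : ∀ i k, Measurable (X i k))
    (hind : iIndepFun (fun p : ι × κ => X p.1 p.2) μ) : iIndepFun (fun i w k => X i k w) μ := by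
  have := hind.isProbabilityMeasure
  have (i : ι) (k : κ) : IsProbabilityMeasure (μ.map (X i k)) :=
    Measure.isProbabilityMeasure_map (hX i k).aemeasurable
  have hrow (i : ι) : μ.map (fun w k => X i k w) = Measure.infinitePi fun k => μ.map (X i k) :=
    (hind.precomp (Prod.mk_right_injective i)).map_fun_eq_infinitePi_map (hX i)
  have hmeas : Measurable fun w (p : ι × κ) => X p.1 p.2 w :=
    measurable_pi_lambda _ fun p => hX p.1 p.2
  have hall : μ.map (fun w (p : ι × κ) => X p.1 p.2 w) =
      Measure.infinitePi fun p : ι × κ => μ.map (X p.1 p.2) :=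
    hind.map_fun_eq_infinitePi_map fun p => hX p.1 p.2
  rw [iIndepFun_iff_map_fun_eq_infinitePi_map fun i => measurable_pi_lambda _ (hX i)]
  simp only [hrow]
  rw [← Measure.infinitePi_map_curry fun i k => μ.map (X i k), ← hall,
    Measure.map_map (MeasurableEquiv.measurable _) hmeas]
  rfl

theorem indepFun_zero_shift {X : ℕ → Ω → E} (hX : ∀ n, Measurable (X n))
    (hind : iIndepFun X μ) : IndepFun (X 0) (fun w n => X (n + 1) w) μ := by
  have := hind.isProbabilityMeasure
  refine IndepFun.indepFun_process (hX 0) (fun n => hX (n + 1)) fun I => ?_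
  have hdisj : Disjoint {0} (I.map (addRightEmbedding 1)) := by simp
  exact (hind.indepFun_finset _ _ hdisj hX).comp
    (φ := fun y : ({0} : Finset ℕ) → E => y ⟨0, Finset.mem_singleton_self 0⟩)
    (ψ := fun (y : I.map (addRightEmbedding 1) → E) (i : I) =>
      y ⟨i + 1, Finset.mem_map_of_mem (addRightEmbedding 1) i.2⟩)
    (measurable_pi_apply _) (measurable_pi_lambda _ fun _ => measurable_pi_apply _)

end Independence

section Orbit

variable {S E : Type*}

/-- The states reached from `s` when step `n` moves by `next` with the input `x n`. -/
def orbit (next : S → E → S) (s : S) (x : ℕ → E) : ℕ → S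
  | 0 => s
  | n + 1 => next (orbit next s x n) (x n)

theorem orbit_succ' (next : S → E → S) (s : S) (x : ℕ → E) (n : ℕ) :
    orbit next s x (n + 1) = orbit next (next s (x 0)) (fun k => x (k + 1)) n := by
  induction n with
  | zero => rfl
  | succ n ih => rw [orbit, ih, orbit]

/-- The product of the weights of the first `n` steps of an orbit. -/
noncomputable def orbitWeight (next : S → E → S) (W : S → E → ℝ≥0∞) (s : S) (x : ℕ → E) (n : ℕ) :
    ℝ≥0∞ :=
  ∏ t ∈ Finset.range n, W (orbit next s x t) (x t)

theorem orbitWeight_succ' (next : S → E → S) (W : S → E → ℝ≥0∞) (s : S) (x : ℕ → E) (n : ℕ) :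
    orbitWeight next W s x (n + 1) =
      W s (x 0) * orbitWeight next W (next s (x 0)) (fun k => x (k + 1)) n := by
  simp only [orbitWeight, Finset.prod_range_succ', orbit_succ']
  exact mul_comm _ _

variable [MeasurableSpace S] [MeasurableSpace E] {next : S → E → S} {W : S → E → ℝ≥0∞}

theorem measurable_orbit (hnext : Measurable fun p : S × E => next p.1 p.2) (n : ℕ) :
    Measurable fun p : S × (ℕ → E) => orbit next p.1 p.2 n := by
  induction n with
  | zero => exact measurable_fst
  | succ n ih =>
    exact hnext.comp (f := fun p : S × (ℕ → E) => (orbit next p.1 p.2 n, p.2 n))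
      (ih.prodMk ((measurable_pi_apply n).comp measurable_snd))

theorem measurable_orbitWeight (hnext : Measurable fun p : S × E => next p.1 p.2)
    (hW : Measurable fun p : S × E => W p.1 p.2) (n : ℕ) :
    Measurable fun p : S × (ℕ → E) => orbitWeight next W p.1 p.2 n :=
  Finset.measurable_prod _ fun t _ =>
    hW.comp (f := fun p : S × (ℕ → E) => (orbit next p.1 p.2 t, p.2 t))
      ((measurable_orbit hnext t).prodMk ((measurable_pi_apply t).comp measurable_snd))

theorem measurable_orbitWeight_right (hnext : Measurable fun p : S × E => next p.1 p.2)
    (hW : Measurable fun p : S × E => W p.1 p.2) (s : S) (n : ℕ) :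
    Measurable fun y : ℕ → E => orbitWeight next W s y n :=
  (measurable_orbitWeight hnext hW n).comp measurable_prodMk_left

theorem measurable_mul_orbitWeight_next (hnext : Measurable fun p : S × E => next p.1 p.2)
    (hW : Measurable fun p : S × E => W p.1 p.2) (s : S) (n : ℕ) :
    Measurable fun p : E × (ℕ → E) => W s p.1 * orbitWeight next W (next s p.1) p.2 n := by
  have hs : Measurable fun p : E × (ℕ → E) => (s, p.1) := measurable_const.prodMk measurable_fst
  exact (hW.comp hs).mul ((measurable_orbitWeight hnext hW n).comp
    (f := fun p : E × (ℕ → E) => (next s p.1, p.2)) ((hnext.comp hs).prodMk measurable_snd))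

-- Condition on the first step: given its input, the remaining steps form an orbit from a fixed
-- state, driven by the independent shifted inputs.
theorem lintegral_orbitWeight_le {Ω : Type*} [MeasurableSpace Ω] {μ : Measure Ω}
    {X : ℕ → Ω → E} (hX : ∀ t, Measurable (X t)) (hind : iIndepFun X μ)
    (hnext : Measurable fun p : S × E => next p.1 p.2)
    (hW : Measurable fun p : S × E => W p.1 p.2) {C : ℝ≥0∞}
    (hC : ∀ t s, ∫⁻ w, W s (X t w) ∂μ ≤ C) (n : ℕ) (s : S) :
    ∫⁻ w, orbitWeight next W s (fun t => X t w) n ∂μ ≤ C ^ n := by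
  have := hind.isProbabilityMeasure
  induction n generalizing X s with
  | zero => simp [orbitWeight]
  | succ n ih =>
    set Y : Ω → ℕ → E := fun w t => X (t + 1) w with hY_def
    have hY : Measurable Y := measurable_pi_lambda _ fun t => hX (t + 1)
    have hWs : Measurable (W s) := hW.comp (f := fun a => (s, a)) measurable_prodMk_left
    have hprod := measurable_mul_orbitWeight_next hnext hW s n
    have hrest (s' : S) : ∫⁻ y, orbitWeight next W s' y n ∂μ.map Y ≤ C ^ n := by
      rw [lintegral_map (measurable_orbitWeight_right hnext hW s' n) hY]
      exact ih (fun t => hX (t + 1)) (hind.precomp (add_left_injective 1))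
        (fun t => hC (t + 1)) s'
    calc ∫⁻ w, orbitWeight next W s (fun t => X t w) (n + 1) ∂μ
        = ∫⁻ w, W s (X 0 w) * orbitWeight next W (next s (X 0 w)) (Y w) n ∂μ := by
          simp only [orbitWeight_succ', hY_def]
      _ = ∫⁻ a, ∫⁻ y, W s a * orbitWeight next W (next s a) y n ∂μ.map Y ∂μ.map (X 0) := by
          rw [← lintegral_prod _ hprod.aemeasurable,
            ← (indepFun_iff_map_prod_eq_prod_map_map (hX 0).aemeasurable hY.aemeasurable).1
              (indepFun_zero_shift hX hind), lintegral_map hprod ((hX 0).prodMk hY)]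
      _ ≤ ∫⁻ a, W s a * C ^ n ∂μ.map (X 0) := by
          refine lintegral_mono fun a => ?_
          dsimp only
          rw [lintegral_const_mul _ (measurable_orbitWeight_right hnext hW _ n)]
          exact mul_le_mul_right (hrest _) _
      _ = (∫⁻ w, W s (X 0 w) ∂μ) * C ^ n := by
          rw [lintegral_mul_const _ hWs, lintegral_map hWs (hX 0)]
      _ ≤ C ^ (n + 1) := by
          rw [pow_succ']
          exact mul_le_mul_left (hC 0 s) _

end Orbit

/-! ### The number of random draws -/

section AverageBound

/-- The bound on an average over `n` calls that a weight `Y` of all of them provides: `Y` is at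
most `4 ^ n` in the mean, so `log Y` is rarely much larger than `4 * n`. -/
noncomputable def averageBound (n : ℕ) (Y : ℝ≥0∞) : ℝ := max 1 (Real.log Y.toReal / (4 * n))

variable {n : ℕ}

theorem averageBound_pos (n : ℕ) (Y : ℝ≥0∞) : 0 < averageBound n Y :=
  zero_lt_one.trans_le (le_max_left _ _)

theorem measurable_averageBound (n : ℕ) : Measurable (averageBound n) :=
  measurable_const.max
    ((Real.measurable_log.comp ENNReal.measurable_toReal).div_const _)

theorem le_mul_averageBound (hn : 0 < n) {Y : ℝ≥0∞} (hY : Y ≠ ⊤) {x : ℝ}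
    (h : ENNReal.ofReal (Real.exp (x / 10)) ≤ Y) : x ≤ 40 * n * averageBound n Y := by
  have hlog := (ENNReal.ofReal_le_iff_le_toReal hY).1 h
  rw [← Real.le_log_iff_exp_le ((Real.exp_pos _).trans_le hlog)] at hlog
  have hmax : Real.log Y.toReal ≤ averageBound n Y * (4 * n) := by
    rw [← div_le_iff₀ (by positivity)]
    exact le_max_right _ _
  linarith

theorem ofReal_exp_le_of_le_averageBound (hn : 0 < n) {Y : ℝ≥0∞} {y : ℝ} (hy : 1 < y)
    (h : y ≤ averageBound n Y) : ENNReal.ofReal (Real.exp (4 * n * y)) ≤ Y := by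
  have hlog : y ≤ Real.log Y.toReal / (4 * n) := (le_max_iff.1 h).resolve_left hy.not_ge
  rw [le_div_iff₀ (by positivity), mul_comm] at hlog
  have hlog_pos : 0 < Real.log Y.toReal := lt_of_lt_of_le (by positivity) hlog
  have hY : 0 < Y.toReal := ENNReal.toReal_nonneg.lt_of_ne fun hzero => by
    simp [← hzero] at hlog_pos
  exact (ENNReal.ofReal_le_ofReal ((Real.le_log_iff_exp_le hY).1 hlog)).trans
    ENNReal.ofReal_toReal_le

theorem four_pow_le_exp (n : ℕ) : (4 : ℝ) ^ n ≤ Real.exp (2 * n) := by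
  have htwo : (2 : ℝ) ≤ Real.exp 1 := by linarith [Real.add_one_le_exp 1]
  calc (4 : ℝ) ^ n = 2 ^ (2 * n) := by rw [pow_mul]; norm_num
    _ ≤ Real.exp 1 ^ (2 * n) := by gcongr
    _ = Real.exp (2 * n) := by rw [← Real.exp_nat_mul]; push_cast; ring_nf

theorem measureReal_averageBound_ge_le {Ω : Type*} [MeasurableSpace Ω] {μ : Measure Ω}
    [IsProbabilityMeasure μ] {Y : Ω → ℝ≥0∞} (hn : 0 < n) (hY : Measurable Y)
    (hmean : ∫⁻ w, Y w ∂μ ≤ 4 ^ n) (y : ℝ) :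
    μ.real {w | y ≤ averageBound n (Y w)} ≤ Real.exp ((1 - y) / 10) := by
  have hn' : (1 : ℝ) ≤ n := by exact_mod_cast hn
  rcases le_or_gt y 1 with hy | hy
  · exact measureReal_le_one.trans (Real.one_le_exp (by linarith))
  have hpow : (4 : ℝ≥0∞) ^ n ≤ ENNReal.ofReal (Real.exp (2 * n)) := by
    refine le_trans (le_of_eq ?_) (ENNReal.ofReal_le_ofReal (four_pow_le_exp n))
    rw [ENNReal.ofReal_pow (by norm_num), ENNReal.ofReal_ofNat]
  refine ENNReal.toReal_le_of_le_ofReal (Real.exp_pos _).le ?_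
  calc μ {w | y ≤ averageBound n (Y w)}
      ≤ μ {w | ENNReal.ofReal (Real.exp (4 * n * y)) ≤ Y w} :=
        measure_mono fun w => ofReal_exp_le_of_le_averageBound hn hy
    _ ≤ (∫⁻ w, Y w ∂μ) / ENNReal.ofReal (Real.exp (4 * n * y)) :=
        meas_ge_le_lintegral_div hY.aemeasurable (by simp [Real.exp_pos]) ENNReal.ofReal_ne_top
    _ ≤ ENNReal.ofReal (Real.exp (2 * n)) / ENNReal.ofReal (Real.exp (4 * n * y)) :=
        ENNReal.div_le_div_right (hmean.trans hpow) _
    _ = ENNReal.ofReal (Real.exp (2 * n - 4 * n * y)) := by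
        rw [← ENNReal.ofReal_div_of_pos (Real.exp_pos _), Real.exp_sub]
    _ ≤ ENNReal.ofReal (Real.exp ((1 - y) / 10)) := by
        gcongr
        nlinarith

end AverageBound

section Uniform

variable {E Ω : Type*} [MeasurableSpace E] [MeasurableSpace Ω] {ν : Measure E} {μ : Measure Ω}
  {X : Ω → E} {K B : Set E}

theorem measure_preimage_le_of_isUniform (hX : Measurable X) (hK : MeasurableSet K)
    (hunif : pdf.IsUniform X K μ ν) (hB : MeasurableSet B) (hK₀ : ν K ≠ 0) (hK' : ν K ≠ ⊤)
    {p : ℝ≥0∞} (h : ν B ≤ p * ν K) : μ (X ⁻¹' B) ≤ p := by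
  rw [← Measure.map_apply hX hB, hunif, cond_apply hK]
  calc (ν K)⁻¹ * ν (K ∩ B) ≤ (ν K)⁻¹ * (p * ν K) := by
        gcongr
        exact (measure_mono Set.inter_subset_right).trans h
    _ = p := by rw [mul_comm, mul_assoc, ENNReal.mul_inv_cancel hK₀ hK', mul_one]

theorem ae_mem_of_isUniform (hX : Measurable X) (hK : MeasurableSet K)
    (hunif : pdf.IsUniform X K μ ν) : ∀ᵐ w ∂μ, X w ∈ K := by
  have h : μ (X ⁻¹' Kᶜ) = 0 := by
    rw [← Measure.map_apply hX hK.compl, hunif, cond_apply hK]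
    simp only [Set.inter_compl_self, measure_empty, mul_zero]
  filter_upwards [compl_mem_ae_iff.2 h] with w hw
  exact Set.not_notMem.1 hw

end Uniform

namespace Procedure

variable {d : ℕ} (A : Procedure d)

/-- The points of the unit ball whose draw a call at `z` rejects. -/
def rejected (z : Vec d) : Set (Vec d) := {x | A.trial z x ∈ A.kept z}

/-- The number of random points that the first `n` calls draw. -/
noncomputable def draws (z₀ : Vec d) (ξ : ℕ → ℕ → Vec d) (n : ℕ) : ℕ :=
  ∑ t ∈ Finset.range n, (A.rejections (orbit A.next z₀ ξ t) (ξ t) + 1)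

/-- The product of the rejection weights of the first `n` calls. -/
noncomputable def drawWeight (z₀ : Vec d) (ξ : ℕ → ℕ → Vec d) (n : ℕ) : ℝ≥0∞ :=
  orbitWeight A.next (fun z => rejectionWeight (A.rejected z)) z₀ ξ n

variable {A} {z₀ : Vec d} {ξ : ℕ → ℕ → Vec d} {n : ℕ}

theorem exp_draws_le_drawWeight :
    ENNReal.ofReal (Real.exp (A.draws z₀ ξ n / 10)) ≤ A.drawWeight z₀ ξ n := by
  rw [draws]
  push_cast
  rw [Finset.sum_div, Real.exp_sum, ENNReal.ofReal_prod_of_nonneg fun _ _ => (Real.exp_pos _).le]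
  exact Finset.prod_le_prod' fun t _ => exp_le_rejectionWeight fun j hj =>
    mem_of_lt_firstOutside hj

theorem exists_trial_notMem_kept_of_drawWeight_ne_top (h : A.drawWeight z₀ ξ n ≠ ⊤) {t : ℕ}
    (ht : t < n) :
    ∃ k, A.trial (orbit A.next z₀ ξ t) (ξ t k) ∉ A.kept (orbit A.next z₀ ξ t) :=
  exists_notMem_of_rejectionWeight_ne_top (B := A.rejected (orbit A.next z₀ ξ t)) <|
    ne_top_of_le_ne_top h <| Finset.single_le_prod'
      (f := fun t => rejectionWeight (A.rejected (orbit A.next z₀ ξ t)) (ξ t))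
      (fun _ _ => one_le_rejectionWeight) (Finset.mem_range.2 ht)

namespace Valid

variable (hA : A.Valid)
include hA

theorem steps_pos : 0 < A.steps := by
  have := hA.cutting.tau_pos
  have : (0 : ℝ) < d := by exact_mod_cast hA.dim_pos
  exact Nat.ceil_pos.2 (mul_pos (by positivity) (zero_lt_one.trans_le (le_max_left _ _)))

theorem one_sub_tau_pow_steps_le :
    (1 - A.τ) ^ A.steps ≤ ((16 * A.smoothness * A.R / (A.ε / 2)) ^ d)⁻¹ := by
  have := hA.cutting.tau_pos
  have := hA.smoothness_pos
  have := hA.ε_pos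
  have := hA.R_pos
  set Y := 16 * A.smoothness * A.R / (A.ε / 2)
  have hY : 0 < Y := by positivity
  have hsteps : (d : ℝ) * Real.log Y ≤ A.τ * A.steps := by
    have h : d / A.τ * Real.log Y ≤ A.steps :=
      (mul_le_mul_of_nonneg_left (le_max_right _ _) (by positivity)).trans (Nat.le_ceil _)
    rwa [div_mul_eq_mul_div, div_le_iff₀' (by positivity)] at h
  calc (1 - A.τ) ^ A.steps ≤ Real.exp (-A.τ) ^ A.steps :=
        pow_le_pow_left₀ (by linarith [hA.cutting.tau_le]) (Real.one_sub_le_exp_neg _) _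
    _ = Real.exp (-(A.τ * A.steps)) := by rw [← Real.exp_nat_mul]; ring_nf
    _ ≤ Real.exp (-(d * Real.log Y)) := Real.exp_le_exp.2 (by linarith)
    _ = (Y ^ d)⁻¹ := by rw [Real.exp_neg, Real.exp_nat_mul, Real.exp_log hY]

theorem one_sub_tau_pow_steps_mul_le :
    (1 - A.τ) ^ A.steps * (A.R / (A.ε / 2 / (8 * A.smoothness))) ^ d ≤ 1 / 2 := by
  have := hA.smoothness_pos
  have := hA.ε_pos
  have := hA.R_pos
  set Y := 16 * A.smoothness * A.R / (A.ε / 2) with hY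
  have hratio : A.R / (A.ε / 2 / (8 * A.smoothness)) = Y * (1 / 2) := by
    rw [hY]
    field_simp
    norm_num
  have : 0 < Y := by positivity
  calc (1 - A.τ) ^ A.steps * (A.R / (A.ε / 2 / (8 * A.smoothness))) ^ d
      ≤ (Y ^ d)⁻¹ * (Y ^ d * (1 / 2) ^ d) := by
        rw [hratio, mul_pow]
        gcongr
        exact hA.one_sub_tau_pow_steps_le
    _ = (1 / 2) ^ d := inv_mul_cancel_left₀ (by positivity) _
    _ ≤ 1 / 2 := pow_le_of_le_one (by norm_num) (by norm_num) hA.dim_pos.ne'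

theorem volume_rejected_le (z : Vec d) :
    volume (A.rejected z) ≤
      ENNReal.ofReal (1 / 2) * volume (Metric.closedBall (0 : Vec d) 1) := by
  set r := A.ε / 2 / (8 * A.smoothness)
  have hr₀ : 0 < r := by
    have := hA.ε_pos
    have := hA.smoothness_pos
    positivity
  set y := (bestQuery (A.queries z)).point - (1 / A.smoothness) • (bestQuery (A.queries z)).slope
  have hpre : A.rejected z = (r • ·) ⁻¹' ((y + ·) ⁻¹' A.kept z) := rfl
  have hkept : volume (A.kept z) ≤
      ENNReal.ofReal ((1 - A.τ) ^ A.steps) * volume (Metric.closedBall (0 : Vec d) A.R) :=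
    hA.cutting.volume_le (A.model z) z A.R A.steps
      (differentiable_penalized hA.differentiable _ _) hA.R_pos hA.steps_pos
  have hτ : 0 ≤ (1 - A.τ) ^ A.steps := pow_nonneg (by linarith [hA.cutting.tau_le]) _
  rw [hpre, Measure.addHaar_preimage_smul _ hr₀.ne', measure_preimage_add]
  rw [Measure.addHaar_closedBall' _ _ hA.R_pos.le] at hkept
  refine (mul_le_mul_right hkept _).trans ?_
  rw [← mul_assoc, ← mul_assoc]
  refine mul_le_mul_left ?_ _
  rw [finrank_euclideanSpace, Fintype.card_fin, ← ENNReal.ofReal_mul (abs_nonneg _),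
    ← ENNReal.ofReal_mul (mul_nonneg (abs_nonneg _) hτ)]
  have hhalf : (1 - A.τ) ^ A.steps * (A.R / r) ^ d ≤ 1 / 2 := hA.one_sub_tau_pow_steps_mul_le
  clear_value r
  refine ENNReal.ofReal_le_ofReal (le_trans (le_of_eq ?_) hhalf)
  rw [abs_of_pos (inv_pos.2 (pow_pos hr₀ d)), div_pow]
  ring

section Random

variable {Ω : Type*} [MeasurableSpace Ω] {Pr : Measure Ω}

theorem measurableSet_rejected (z : Vec d) : MeasurableSet (A.rejected z) :=
  measurable_prodMk_left hA.measurableSet_trial_mem_kept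

theorem measure_preimage_rejected_le {X : Ω → Vec d} (hX : Measurable X)
    (hunif : pdf.IsUniform X (Metric.closedBall 0 1) Pr volume) (z : Vec d) :
    Pr (X ⁻¹' A.rejected z) ≤ ENNReal.ofReal (1 / 2) :=
  measure_preimage_le_of_isUniform hX Metric.isClosed_closedBall.measurableSet hunif
    (hA.measurableSet_rejected z) (Metric.measure_closedBall_pos volume 0 one_pos).ne'
    (isCompact_closedBall (0 : Vec d) 1).measure_lt_top.ne (hA.volume_rejected_le z)

theorem measurable_rejectionWeight :
    Measurable fun p : Vec d × (ℕ → Vec d) => rejectionWeight (A.rejected p.1) p.2 := by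
  refine Measurable.tsum fun k => Measurable.const_mul (Finset.measurable_prod _ fun j _ => ?_) _
  exact ((measurable_const (a := (1 : ℝ≥0∞))).indicator hA.measurableSet_trial_mem_kept).comp
    (f := fun p : Vec d × (ℕ → Vec d) => (p.1, p.2 j))
    (measurable_fst.prodMk ((measurable_pi_apply j).comp measurable_snd))

variable {ξ : ℕ → ℕ → Ω → Vec d} (hξ : ∀ t k, Measurable (ξ t k))
include hξ

theorem measurable_drawWeight (z₀ : Vec d) (n : ℕ) :
    Measurable fun w => A.drawWeight z₀ (fun t k => ξ t k w) n :=
  (measurable_orbitWeight_right hA.measurable_next hA.measurable_rejectionWeight z₀ n).comp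
    (measurable_pi_lambda _ fun t => measurable_pi_lambda _ (hξ t))

variable (hunif : ∀ t k, pdf.IsUniform (ξ t k) (Metric.closedBall 0 1) Pr volume)
  (hind : iIndepFun (fun i : ℕ × ℕ => ξ i.1 i.2) Pr)
include hunif hind

theorem lintegral_drawWeight_le (z₀ : Vec d) (n : ℕ) :
    ∫⁻ w, A.drawWeight z₀ (fun t k => ξ t k w) n ∂Pr ≤ 4 ^ n := by
  refine lintegral_orbitWeight_le (fun t => measurable_pi_lambda _ (hξ t))
    (iIndepFun_curry hξ hind) hA.measurable_next hA.measurable_rejectionWeight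
    (fun t z => ?_) n z₀
  have hcall : iIndepFun (ξ t) Pr :=
    hind.precomp (g := fun k => (t, k)) (Prod.mk_right_injective t)
  exact lintegral_rejectionWeight_le (hξ t) hcall (hA.measurableSet_rejected z)
    fun k => hA.measure_preimage_rejected_le (hξ t k) (hunif t k) z

theorem exists_draws_le (z₀ : Vec d) {n : ℕ} (hn : 0 < n) :
    ∃ Kbar : Ω → ℝ, Measurable Kbar ∧ (∀ w, 0 < Kbar w) ∧
      (∀ y : ℝ, Pr.real {w | y ≤ Kbar w} ≤ Real.exp ((1 - y) / 10)) ∧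
      ∀ᵐ w ∂Pr, (∀ t < n, ∃ k, A.trial (orbit A.next z₀ (fun t k => ξ t k w) t) (ξ t k w) ∉
          A.kept (orbit A.next z₀ (fun t k => ξ t k w) t)) ∧
        (A.draws z₀ (fun t k => ξ t k w) n : ℝ) ≤ 40 * n * Kbar w := by
  have := hind.isProbabilityMeasure
  have hY := hA.measurable_drawWeight hξ z₀ n
  have hmean := hA.lintegral_drawWeight_le hξ hunif hind z₀ n
  have hfinite := ae_lt_top hY (hmean.trans_lt (by finiteness)).ne
  refine ⟨fun w => averageBound n (A.drawWeight z₀ (fun t k => ξ t k w) n),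
    (measurable_averageBound n).comp hY, fun w => averageBound_pos _ _,
    measureReal_averageBound_ge_le hn hY hmean, ?_⟩
  filter_upwards [hfinite] with w hw
  exact ⟨fun t ht => exists_trial_notMem_kept_of_drawWeight_ne_top hw.ne ht,
    le_mul_averageBound hn hw.ne exp_draws_le_drawWeight⟩

end Random

end Valid

end Procedure

/-! ### The price of the procedure -/

theorem repeatedCalls_succ {d : ℕ} (P : Prices) (centre : Set (Vec d) → Vec d) (e : Vec d) (τ : ℝ)
    (eig : (Vec d →L[ℝ] Vec d) → Vec d) (f : Vec d → ℝ) (z₀ : Vec d) (ε L₁ L₃ R : ℝ)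
    (ξ : ℕ → ℕ → Vec d) (n : ℕ) :
    repeatedCalls P centre e τ eig f z₀ ε L₁ L₃ R ξ (n + 1) =
      (repeatedCalls P centre e τ eig f z₀ ε L₁ L₃ R ξ n >>= fun z =>
        cuttingTrustRegion P centre e τ eig f z ε L₁ L₃ R (ξ n) >>= fun p =>
          charge (P.T2 + P.svd d + 2 * P.vec d) p.1) := by
  change (do
    let z ← repeatedCalls P centre e τ eig f z₀ ε L₁ L₃ R ξ n
    let (zplus, _) ← cuttingTrustRegion P centre e τ eig f z ε L₁ L₃ R (ξ n)
    charge (P.T2 + P.svd d + 2 * P.vec d) zplus) = _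
  exact congrArg (bind _) (funext fun z => congrArg (bind _) (funext fun ⟨_, _⟩ => rfl))

namespace Procedure

variable {d : ℕ} (A : Procedure d)

/-- The first `n` calls from `z₀` with the draws `ξ`, including the termination tests. -/
noncomputable def run (z₀ : Vec d) (ξ : ℕ → ℕ → Vec d) (n : ℕ) : Timed (Vec d) :=
  repeatedCalls A.P A.centre A.e A.τ A.eig A.f z₀ A.ε A.L₁ A.L₃ A.R ξ n

theorem run_succ (z₀ : Vec d) (ξ : ℕ → ℕ → Vec d) (n : ℕ) :
    A.run z₀ ξ (n + 1) = (A.run z₀ ξ n >>= fun z => A.call z (ξ n) >>= fun p =>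
      charge (A.P.T2 + A.P.svd d + 2 * A.P.vec d) p.1) := by
  unfold run call
  exact repeatedCalls_succ ..

theorem run_val (z₀ : Vec d) (ξ : ℕ → ℕ → Vec d) (n : ℕ) :
    (A.run z₀ ξ n).val = orbit A.next z₀ ξ n := by
  induction n with
  | zero => rfl
  | succ n ih => simp only [run_succ, Timed.val_bind, Timed.val_charge, call_val_fst, ih, orbit]

/-- A bound on the price of a call and of a termination test, without the random draws. -/
noncomputable def callPrice : ℝ≥0 :=
  (A.steps + 7) * (A.P.T1 + 12 * A.P.vec d) + A.steps * A.P.TC + 2 * A.P.T2 + 3 * A.P.svd d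

/-- A bound on the price of a random draw, mostly the tests whether it lies in the region. -/
noncomputable def drawPrice : ℝ≥0 := (2 * A.steps + 7) * A.P.vec d

theorem run_time_le (z₀ : Vec d) (ξ : ℕ → ℕ → Vec d) (n : ℕ)
    (h : ∀ t < n, ∃ k, A.trial (orbit A.next z₀ ξ t) (ξ t k) ∉ A.kept (orbit A.next z₀ ξ t)) :
    (A.run z₀ ξ n).time ≤
      (((n + 1) * A.callPrice + A.draws z₀ ξ n * A.drawPrice : ℝ≥0) : ℝ≥0∞) := by
  have := (A.P.vec d).coe_nonneg
  have := A.P.T1.coe_nonneg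
  have := (A.P.svd d).coe_nonneg
  have := A.P.T2.coe_nonneg
  have hsteps_vec : (0 : ℝ) ≤ A.steps * A.P.vec d := by positivity
  have hsteps_T1 : (0 : ℝ) ≤ A.steps * A.P.T1 := by positivity
  have hsteps_TC : (0 : ℝ) ≤ A.steps * A.P.TC := by positivity
  induction n with
  | zero =>
    change ((A.P.T2 + A.P.svd d + 2 * A.P.vec d : ℝ≥0) : ℝ≥0∞) ≤ _
    rw [ENNReal.coe_le_coe, ← NNReal.coe_le_coe, callPrice, draws, Finset.sum_range_zero]
    push_cast
    linarith
  | succ n ih =>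
    have hrun := ih fun t ht => h t (ht.trans n.lt_succ_self)
    have hcall := A.call_time_le (orbit A.next z₀ ξ n) (h n n.lt_succ_self)
    rw [run_succ, Timed.time_bind, Timed.time_bind, run_val, Timed.time_charge]
    refine (add_le_add hrun (add_le_add hcall le_rfl)).trans ?_
    simp only [← ENNReal.coe_add, ENNReal.coe_le_coe]
    rw [← NNReal.coe_le_coe]
    simp only [callPrice, drawPrice, draws, Finset.sum_range_succ]
    push_cast
    linarith

variable {A}

theorem draws_mono (z₀ : Vec d) (ξ : ℕ → ℕ → Vec d) : Monotone (A.draws z₀ ξ) := fun _ _ h =>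
  Finset.sum_le_sum_of_subset (Finset.range_subset_range.2 h)

namespace Valid

variable (hA : A.Valid) {z₀ : Vec d} {Δ : ℝ} (hbdd : BddBelow (Set.range A.f))
  (hΔ : A.f z₀ - ⨅ x, A.f x ≤ Δ)
include hA hbdd hΔ

theorem exists_isApproxStationary_orbit {ξ : ℕ → ℕ → Vec d} {n : ℕ} (hn : Δ < n * A.decrease)
    (hξ : ∀ t k, ‖ξ t k‖ ≤ 1)
    (h : ∀ t < n, ∃ k, A.trial (orbit A.next z₀ ξ t) (ξ t k) ∉ A.kept (orbit A.next z₀ ξ t)) :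
    ∃ m ≤ n, IsApproxStationary A.f A.ε A.penalty (orbit A.next z₀ ξ m) := by
  by_contra! hnone
  have hdecrease : ∀ t ≤ n, A.f (orbit A.next z₀ ξ t) ≤ A.f z₀ - t * A.decrease := by
    intro t
    induction t with
    | zero => simp [orbit]
    | succ t ih =>
      intro ht
      have hnext : A.f (orbit A.next z₀ ξ (t + 1)) ≤ A.f (orbit A.next z₀ ξ t) - A.decrease :=
        (hA.isApproxStationary_or_f_next_le (hξ t) (h t ht)).resolve_left (hnone (t + 1) ht)
      push_cast
      linarith [ih (Nat.le_of_succ_le ht)]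
  linarith [hdecrease n le_rfl, ciInf_le hbdd (orbit A.next z₀ ξ n)]

theorem exists_isLeast_run_time_le_of_draws_le {ξ : ℕ → ℕ → Vec d} {n : ℕ} {K : ℝ}
    (hn : Δ < n * A.decrease) (hξ : ∀ t k, ‖ξ t k‖ ≤ 1)
    (h : ∀ t < n, ∃ k, A.trial (orbit A.next z₀ ξ t) (ξ t k) ∉ A.kept (orbit A.next z₀ ξ t))
    (hK : 0 ≤ K) (hdraws : A.draws z₀ ξ n ≤ n * K) :
    ∃ m, IsLeast {t | IsApproxStationary A.f A.ε A.penalty (A.run z₀ ξ t).val} m ∧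
      (A.run z₀ ξ m).time ≤ ENNReal.ofReal ((n + 1) * (A.callPrice + K * A.drawPrice)) := by
  classical
  obtain ⟨k, hkn, hk⟩ := hA.exists_isApproxStationary_orbit hbdd hΔ hn hξ h
  rw [← run_val] at hk
  have hex : ∃ m, IsApproxStationary A.f A.ε A.penalty (A.run z₀ ξ m).val := ⟨k, hk⟩
  have hmn : Nat.find hex ≤ n := (Nat.find_min' hex hk).trans hkn
  refine ⟨Nat.find hex, ⟨Nat.find_spec hex, fun t => Nat.find_min' hex⟩, ?_⟩
  refine (A.run_time_le z₀ ξ _ fun t ht => h t (ht.trans_le hmn)).trans ?_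
  rw [← ENNReal.ofReal_coe_nnreal]
  refine ENNReal.ofReal_le_ofReal ?_
  have hdraws' : (A.draws z₀ ξ (Nat.find hex) : ℝ) ≤ (n + 1) * K :=
    (Nat.cast_le.2 (draws_mono z₀ ξ hmn)).trans (hdraws.trans (by gcongr; linarith))
  push_cast
  calc ((Nat.find hex : ℝ) + 1) * A.callPrice + A.draws z₀ ξ (Nat.find hex) * A.drawPrice
      ≤ (n + 1) * A.callPrice + (n + 1) * K * A.drawPrice := by gcongr
    _ = (n + 1) * (A.callPrice + K * A.drawPrice) := by ring

theorem exists_isLeast_run_time_le {Ω : Type*} [MeasurableSpace Ω] {Pr : Measure Ω}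
    {ξ : ℕ → ℕ → Ω → Vec d} (hξ : ∀ t k, Measurable (ξ t k))
    (hunif : ∀ t k, pdf.IsUniform (ξ t k) (Metric.closedBall 0 1) Pr volume)
    (hind : iIndepFun (fun i : ℕ × ℕ => ξ i.1 i.2) Pr) :
    ∃ Kbar : Ω → ℝ, Measurable Kbar ∧ (∀ w, 0 < Kbar w) ∧
      (∀ y : ℝ, Pr.real {w | y ≤ Kbar w} ≤ Real.exp ((1 - y) / 10)) ∧
      ∀ᵐ w ∂Pr, ∃ m : ℕ,
        IsLeast {t : ℕ | IsApproxStationary A.f A.ε A.penalty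
          (A.run z₀ (fun t k => ξ t k w) t).val} m ∧
        (A.run z₀ (fun t k => ξ t k w) m).time ≤ ENNReal.ofReal
          ((Δ / A.decrease + 2) * (A.callPrice + 40 * Kbar w * A.drawPrice)) := by
  set n := ⌊Δ / A.decrease⌋₊ + 1 with hn_def
  have hn : Δ < n * A.decrease := by
    rw [← div_lt_iff₀ hA.decrease_pos, hn_def]
    exact_mod_cast Nat.lt_floor_add_one (Δ / A.decrease)
  have hn' : (n : ℝ) + 1 ≤ Δ / A.decrease + 2 := by
    have hΔ₀ : 0 ≤ Δ := (sub_nonneg.2 (ciInf_le hbdd z₀)).trans hΔ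
    have hfloor := Nat.floor_le (div_nonneg hΔ₀ hA.decrease_pos.le)
    rw [hn_def]
    push_cast
    linarith
  have hball : ∀ᵐ w ∂Pr, ∀ t k, ξ t k w ∈ Metric.closedBall 0 1 :=
    ae_all_iff.2 fun t => ae_all_iff.2 fun k =>
      ae_mem_of_isUniform (hξ t k) Metric.isClosed_closedBall.measurableSet (hunif t k)
  obtain ⟨Kbar, hmeas, hpos, htail, hdraws⟩ :=
    hA.exists_draws_le hξ hunif hind z₀ (Nat.succ_pos _ : 0 < n)
  refine ⟨Kbar, hmeas, hpos, htail, ?_⟩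
  filter_upwards [hdraws, hball] with w ⟨hout, hdraw⟩ hw
  have hK := (hpos w).le
  obtain ⟨m, hm, htime⟩ := hA.exists_isLeast_run_time_le_of_draws_le hbdd hΔ (K := 40 * Kbar w)
    hn (fun t k => mem_closedBall_zero_iff.1 (hw t k)) hout (by positivity) (by linarith)
  exact ⟨m, hm, htime.trans (by gcongr)⟩

end Valid

end Procedure

/-! ### The dependence on the parameters -/

theorem one_le_logPlus (x : ℝ) : 1 ≤ logPlus x := le_max_left _ _

theorem log_max_one_le_logPlus_pow (x : ℝ) {k : ℕ} (hk : k ≠ 0) :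
    Real.log (max 1 x) ≤ logPlus (x ^ k) := by
  rcases le_total x 1 with hx | hx
  · rw [max_eq_left hx, Real.log_one]
    exact zero_le_one.trans (one_le_logPlus _)
  · rw [max_eq_right hx]
    refine le_trans ?_ (le_max_right _ _)
    rw [Real.log_pow]
    exact le_mul_of_one_le_left (Real.log_nonneg hx) (by exact_mod_cast Nat.one_le_iff_ne_zero.2 hk)

theorem logPlus_affine_le {a b x : ℝ} (ha : 0 < a) (hb : 0 ≤ b) (hx : 0 ≤ x) {k : ℕ}
    (hk : k ≠ 0) :
    logPlus (a * x + b) ≤ (1 + |Real.log (a + b)|) * logPlus (x ^ k) := by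
  have hone := one_le_logPlus (x ^ k)
  have habs := abs_nonneg (Real.log (a + b))
  have habs_mul := le_mul_of_one_le_right habs hone
  refine max_le (by linarith) ?_
  rcases (add_nonneg (mul_nonneg ha.le hx) hb).eq_or_lt with h | h
  · rw [← h, Real.log_zero]
    positivity
  have hmax : 0 < max 1 x := lt_max_of_lt_left one_pos
  calc Real.log (a * x + b) ≤ Real.log ((a + b) * max 1 x) := by
        refine Real.log_le_log h ?_
        rw [add_mul]
        exact add_le_add (mul_le_mul_of_nonneg_left (le_max_right _ _) ha.le)
          (le_mul_of_one_le_right hb (le_max_left _ _))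
    _ = Real.log (a + b) + Real.log (max 1 x) := Real.log_mul (by positivity) hmax.ne'
    _ ≤ |Real.log (a + b)| + logPlus (x ^ k) :=
        add_le_add (le_abs_self _) (log_max_one_le_logPlus_pow x hk)
    _ ≤ (1 + |Real.log (a + b)|) * logPlus (x ^ k) := by linarith

theorem pow_three_rpow_div_three {a : ℝ} (ha : 0 ≤ a) (r : ℝ) : (a ^ 3) ^ (r / 3) = a ^ r := by
  rw [← Real.rpow_natCast, ← Real.rpow_mul ha]
  congr 1
  push_cast
  ring

theorem exists_pos_pow_three_eq {x : ℝ} (hx : 0 < x) : ∃ a, 0 < a ∧ x = a ^ 3 :=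
  ⟨x ^ (1 / 3 : ℝ), by positivity, by
    rw [← Real.rpow_natCast, ← Real.rpow_mul hx.le]
    norm_num⟩

/-- A lower bound on the guaranteed decrease of a call in units of `L₃ ^ (-1/3) * ε ^ (4/3)`, for
the radius `ρ * L₃ ^ (-1/3) * ε ^ (1/3)`. -/
noncomputable def decreaseFactor (ρ : ℝ) : ℝ := min (1 / (168 * ρ ^ 2)) (10 * ρ ^ 4)

/-- A bound on half the number of cutting plane steps of a call in units of
`d / τ * logPlus (L₁ ^ 3 / (ε ^ 2 * L₃))`, for the radius `ρ * L₃ ^ (-1/3) * ε ^ (1/3)`. -/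
noncomputable def stepFactor (ρ : ℝ) : ℝ := 1 + |Real.log (32 * ρ + 672 * ρ ^ 3)|

/-- The constant in the bound on the price of a call when the elementary operations have the
price constant `c`. -/
noncomputable def priceFactor (c : ℝ) : ℝ := 9 * (1 + 12 * c ^ 2) + 2 + 443 * c

theorem decreaseFactor_pos {ρ : ℝ} (hρ : 0 < ρ) : 0 < decreaseFactor ρ :=
  lt_min (by positivity) (by positivity)

theorem one_le_stepFactor (ρ : ℝ) : 1 ≤ stepFactor ρ := le_add_of_nonneg_right (abs_nonneg _)

theorem priceFactor_pos {c : ℝ} (hc : 0 ≤ c) : 0 < priceFactor c := by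
  unfold priceFactor
  positivity

namespace Procedure

variable {d : ℕ} {A : Procedure d}

theorem callPrice_add_drawPrice_le {K s : ℝ} (hK : 0 ≤ K) (hs : 1 ≤ s)
    (hsteps : A.steps ≤ 2 * s) (hd : (d : ℝ≥0) ≤ A.P.c * A.P.T1) :
    A.callPrice + 40 * K * A.drawPrice ≤ priceFactor A.P.c *
      ((A.P.TC + A.P.T1 + K * d) * s + A.P.T2 + (d : ℝ) ^ A.P.ω) := by
  simp only [callPrice, drawPrice, Prices.vec, Prices.svd]
  push_cast
  have hc := A.P.c.coe_nonneg
  set c : ℝ := (A.P.c : ℝ)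
  have hvec : c * d ≤ c ^ 2 * A.P.T1 := by
    rw [pow_two, mul_assoc]
    exact mul_le_mul_of_nonneg_left (by exact_mod_cast hd) hc
  have hqueries : (A.steps + 7) * (A.P.T1 + 12 * (c * d)) ≤
      9 * (1 + 12 * c ^ 2) * (s * A.P.T1) := by
    calc (A.steps + 7) * (A.P.T1 + 12 * (c * d))
        ≤ 9 * s * (A.P.T1 + 12 * (c ^ 2 * A.P.T1)) := by gcongr; linarith
      _ = 9 * (1 + 12 * c ^ 2) * (s * A.P.T1) := by ring
  have hcentres : A.steps * A.P.TC ≤ 2 * (s * A.P.TC) := by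
    rw [← mul_assoc]
    gcongr
  have hdraws : 40 * K * ((2 * A.steps + 7) * (c * d)) ≤ 440 * c * (s * (K * d)) := by
    calc 40 * K * ((2 * A.steps + 7) * (c * d)) ≤ 40 * K * (11 * s * (c * d)) := by
          gcongr
          linarith
      _ = 440 * c * (s * (K * d)) := by ring
  have hsq : 0 ≤ c ^ 2 := sq_nonneg c
  calc _ ≤ 9 * (1 + 12 * c ^ 2) * (s * A.P.T1) + 2 * (s * A.P.TC) + 2 * A.P.T2 +
        3 * c * (d : ℝ) ^ A.P.ω + 440 * c * (s * (K * d)) := by linarith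
    _ ≤ priceFactor c * (s * A.P.T1) + priceFactor c * (s * A.P.TC) + priceFactor c * A.P.T2 +
        priceFactor c * (d : ℝ) ^ A.P.ω + priceFactor c * (s * (K * d)) := by
      unfold priceFactor
      gcongr <;> linarith
    _ = priceFactor c * ((A.P.TC + A.P.T1 + K * d) * s + A.P.T2 + (d : ℝ) ^ A.P.ω) := by ring

namespace Valid

variable (hA : A.Valid)
include hA

theorem one_le_dim_div_tau : 1 ≤ (d : ℝ) / A.τ := by
  rw [one_le_div hA.cutting.tau_pos]
  have : (1 : ℝ) ≤ d := by exact_mod_cast hA.dim_pos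
  linarith [hA.cutting.tau_le]

variable {ρ : ℝ} (hR : A.R = ρ * A.L₃ ^ (-1 / 3 : ℝ) * A.ε ^ (1 / 3 : ℝ))
include hR

theorem penalty_eq :
    A.penalty = 21 * ρ ^ 2 * (A.L₃ ^ (1 / 3 : ℝ) * A.ε ^ (2 / 3 : ℝ)) := by
  obtain ⟨a, ha, hL₃⟩ := exists_pos_pow_three_eq hA.L₃_pos
  obtain ⟨b, hb, hε⟩ := exists_pos_pow_three_eq hA.ε_pos
  rw [penalty, hR, hL₃, hε]
  simp only [pow_three_rpow_div_three ha.le, pow_three_rpow_div_three hb.le, Real.rpow_one,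
    Real.rpow_neg_one, Real.rpow_two]
  field_simp

theorem decrease_eq :
    A.decrease = decreaseFactor ρ * (A.L₃ ^ (-1 / 3 : ℝ) * A.ε ^ (4 / 3 : ℝ)) := by
  obtain ⟨a, ha, hL₃⟩ := exists_pos_pow_three_eq hA.L₃_pos
  obtain ⟨b, hb, hε⟩ := exists_pos_pow_three_eq hA.ε_pos
  rw [decrease, hA.penalty_eq hR, hR, hL₃, hε, decreaseFactor,
    min_mul_of_nonneg _ _ (by positivity)]
  simp only [pow_three_rpow_div_three ha.le, pow_three_rpow_div_three hb.le, Real.rpow_one,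
    Real.rpow_neg_one, Real.rpow_ofNat]
  congr 1 <;> field_simp
  norm_num

theorem div_decrease_eq (Δ : ℝ) :
    Δ / A.decrease =
      (decreaseFactor ρ)⁻¹ * (Δ * A.L₃ ^ (1 / 3 : ℝ) * A.ε ^ (-4 / 3 : ℝ)) := by
  rw [hA.decrease_eq hR, neg_div, neg_div, Real.rpow_neg hA.L₃_pos.le, Real.rpow_neg hA.ε_pos.le]
  simp only [div_eq_mul_inv, mul_inv, inv_inv]
  ring

theorem smoothness_mul_R_div_ε_eq :
    16 * A.smoothness * A.R / (A.ε / 2) =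
      32 * ρ * (A.L₁ ^ 3 / (A.ε ^ 2 * A.L₃)) ^ (1 / 3 : ℝ) + 672 * ρ ^ 3 := by
  obtain ⟨a, ha, hL₃⟩ := exists_pos_pow_three_eq hA.L₃_pos
  obtain ⟨b, hb, hε⟩ := exists_pos_pow_three_eq hA.ε_pos
  have hL₁ := hA.L₁_pos
  have hratio : A.L₁ ^ 3 / (A.ε ^ 2 * A.L₃) = (A.L₁ / (b ^ 2 * a)) ^ 3 := by
    rw [hL₃, hε]
    field_simp
  rw [hratio, pow_three_rpow_div_three (by positivity), smoothness, hA.penalty_eq hR, hR, hL₃, hε]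
  simp only [pow_three_rpow_div_three ha.le, pow_three_rpow_div_three hb.le, Real.rpow_one,
    Real.rpow_neg_one, Real.rpow_two]
  field_simp
  ring

theorem steps_le (hρ : 0 < ρ) :
    (A.steps : ℝ) ≤
      2 * (stepFactor ρ * (d / A.τ * logPlus (A.L₁ ^ 3 / (A.ε ^ 2 * A.L₃)))) := by
  have hτ := hA.cutting.tau_pos
  have hx : 0 ≤ A.L₁ ^ 3 / (A.ε ^ 2 * A.L₃) := by
    have := hA.L₁_pos
    have := hA.L₃_pos
    positivity
  set x := A.L₁ ^ 3 / (A.ε ^ 2 * A.L₃) with hx_def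
  have hcube : (x ^ (1 / 3 : ℝ)) ^ 3 = x := by
    rw [← Real.rpow_natCast, ← Real.rpow_mul hx]
    norm_num
  have hlog : logPlus (16 * A.smoothness * A.R / (A.ε / 2)) ≤ stepFactor ρ * logPlus x := by
    rw [hA.smoothness_mul_R_div_ε_eq hR, ← hx_def, stepFactor]
    nth_rw 2 [← hcube]
    exact logPlus_affine_le (by positivity) (by positivity) (by positivity) three_ne_zero
  have hone : 1 ≤ stepFactor ρ * (d / A.τ * logPlus x) :=
    one_le_mul_of_one_le_of_one_le (one_le_stepFactor ρ)
      (one_le_mul_of_one_le_of_one_le hA.one_le_dim_div_tau (one_le_logPlus x))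
  have hceil : (A.steps : ℝ) < d / A.τ * logPlus (16 * A.smoothness * A.R / (A.ε / 2)) + 1 :=
    Nat.ceil_lt_add_one (mul_nonneg (by positivity) (zero_le_one.trans (one_le_logPlus _)))
  have hmul : d / A.τ * logPlus (16 * A.smoothness * A.R / (A.ε / 2)) ≤
      d / A.τ * (stepFactor ρ * logPlus x) := by gcongr
  linarith

theorem price_le (hρ : 0 < ρ) (hd : (d : ℝ≥0) ≤ A.P.c * A.P.T1) {Δ K : ℝ} (hΔ : 0 ≤ Δ)
    (hK : 0 ≤ K) :
    (Δ / A.decrease + 2) * (A.callPrice + 40 * K * A.drawPrice) ≤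
      ((decreaseFactor ρ)⁻¹ + 2) * (priceFactor A.P.c * stepFactor ρ) *
        ((Δ * A.L₃ ^ (1 / 3 : ℝ) * A.ε ^ (-4 / 3 : ℝ) + 1) *
          ((A.P.TC + A.P.T1 + K * d) * d / A.τ * logPlus (A.L₁ ^ 3 / (A.ε ^ 2 * A.L₃))
            + A.P.T2 + (d : ℝ) ^ A.P.ω)) := by
  have hC := one_le_stepFactor ρ
  have hE := priceFactor_pos A.P.c.coe_nonneg
  have hκ := decreaseFactor_pos hρ
  have hL₃ := hA.L₃_pos
  have hε := hA.ε_pos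
  have hs := one_le_mul_of_one_le_of_one_le hA.one_le_dim_div_tau
    (one_le_logPlus (A.L₁ ^ 3 / (A.ε ^ 2 * A.L₃)))
  set s := d / A.τ * logPlus (A.L₁ ^ 3 / (A.ε ^ 2 * A.L₃)) with hs_def
  have hcall := callPrice_add_drawPrice_le hK (one_le_mul_of_one_le_of_one_le hC hs)
    (hA.steps_le hR hρ) hd
  have hcalls : Δ / A.decrease + 2 ≤ ((decreaseFactor ρ)⁻¹ + 2) *
      (Δ * A.L₃ ^ (1 / 3 : ℝ) * A.ε ^ (-4 / 3 : ℝ) + 1) := by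
    rw [hA.div_decrease_eq hR]
    have : 0 ≤ Δ * A.L₃ ^ (1 / 3 : ℝ) * A.ε ^ (-4 / 3 : ℝ) := by positivity
    have : 0 < (decreaseFactor ρ)⁻¹ := inv_pos.2 hκ
    linarith
  calc (Δ / A.decrease + 2) * (A.callPrice + 40 * K * A.drawPrice)
      ≤ _ * _ := mul_le_mul hcalls hcall (by positivity) (by positivity)
    _ ≤ ((decreaseFactor ρ)⁻¹ + 2) * (Δ * A.L₃ ^ (1 / 3 : ℝ) * A.ε ^ (-4 / 3 : ℝ) + 1) *
        (priceFactor A.P.c * ((A.P.TC + A.P.T1 + K * d) * (stepFactor ρ * s) +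
          stepFactor ρ * A.P.T2 + stepFactor ρ * (d : ℝ) ^ A.P.ω)) := by
      gcongr
      · exact le_mul_of_one_le_left A.P.T2.coe_nonneg hC
      · exact le_mul_of_one_le_left (by positivity) hC
    _ = _ := by
      rw [hs_def]
      ring

end Valid

end Procedure

end CutNC

open CutNC in
theorem mainTheorem1_general (ρ : ℝ) (hρ : 0 < ρ) (c : ℝ≥0) :
    ∃ C : ℝ, 0 < C ∧
      ∀ (d : ℕ) (_ : 0 < d) (ω : ℝ) (T1 T2 TC : ℝ≥0) (_ : (d : ℝ≥0) ≤ c * T1)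
        (centre : Set (Vec d) → Vec d) (e : Vec d) (τ : ℝ)
        (_ : CuttingPlaneAssumption ⟨c, ω, T1, T2, TC⟩ centre e τ)
        (eig : (Vec d →L[ℝ] Vec d) → Vec d) (_ : IsMinDirection eig)
        (f : Vec d → ℝ) (z₀ : Vec d) (L₁ L₃ ε Δ : ℝ)
        (_ : 0 < L₁) (_ : 0 < L₃) (_ : 0 < ε)
        (_ : HasLipschitzDeriv 1 L₁ f) (_ : HasLipschitzDeriv 3 L₃ f)
        (_ : BddBelow (Set.range f)) (_ : f z₀ - ⨅ x, f x ≤ Δ)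
        (Ω : Type*) (_ : MeasurableSpace Ω) (Pr : Measure Ω)
        (ξ : ℕ → ℕ → Ω → Vec d) (_ : ∀ t k, Measurable (ξ t k))
        (_ : ∀ t k, pdf.IsUniform (ξ t k) (Metric.closedBall 0 1) Pr volume)
        (_ : iIndepFun (fun i : ℕ × ℕ => ξ i.1 i.2) Pr),
        ∃ Kbar : Ω → ℝ, Measurable Kbar ∧ (∀ w, 0 < Kbar w) ∧
          (∀ y : ℝ, Pr.real {w | y ≤ Kbar w} ≤ Real.exp ((1 - y) / 10)) ∧
          ∀ᵐ w ∂Pr, ∃ m : ℕ,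
            let run := repeatedCalls ⟨c, ω, T1, T2, TC⟩ centre e τ eig f z₀ ε L₁ L₃
              (ρ * L₃ ^ (-1 / 3 : ℝ) * ε ^ (1 / 3 : ℝ)) (fun t k => ξ t k w)
            IsLeast {t : ℕ | IsApproxStationary f ε
              (21 * ρ ^ 2 * (L₃ ^ (1 / 3 : ℝ) * ε ^ (2 / 3 : ℝ))) (run t).val} m ∧
            (run m).time ≤ ENNReal.ofReal
              (C * ((Δ * L₃ ^ (1 / 3 : ℝ) * ε ^ (-4 / 3 : ℝ) + 1) *
                ((TC + T1 + Kbar w * d) * d / τ * logPlus (L₁ ^ 3 / (ε ^ 2 * L₃))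
                  + T2 + (d : ℝ) ^ ω))) := by
  have hκ := decreaseFactor_pos hρ
  have hE := priceFactor_pos c.coe_nonneg
  have hC := zero_lt_one.trans_le (one_le_stepFactor ρ)
  refine ⟨((decreaseFactor ρ)⁻¹ + 2) * (priceFactor c * stepFactor ρ), by positivity, ?_⟩
  intro d hd ω T1 T2 TC hdT centre e τ hcut eig heig f z₀ L₁ L₃ ε Δ hL₁ hL₃ hε hlip₁ hlip₃
    hbdd hΔ Ω _ Pr ξ hξ hunif hind
  let A : Procedure d := ⟨⟨c, ω, T1, T2, TC⟩, centre, e, τ, eig, f, ε, L₁, L₃,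
    ρ * L₃ ^ (-1 / 3 : ℝ) * ε ^ (1 / 3 : ℝ)⟩
  have hA : A.Valid := ⟨hd, hcut, heig, hL₁, hL₃, hε, show 0 < ρ * _ * _ by positivity,
    hlip₁, hlip₃⟩
  have hΔ₀ : 0 ≤ Δ := (sub_nonneg.2 (ciInf_le hbdd z₀)).trans hΔ
  obtain ⟨Kbar, hmeas, hpos, htail, hrun⟩ := hA.exists_isLeast_run_time_le hbdd hΔ hξ hunif hind
  rw [hA.penalty_eq rfl] at hrun
  refine ⟨Kbar, hmeas, hpos, htail, hrun.mono fun w ⟨m, hm, htime⟩ => ⟨m, hm, htime.trans ?_⟩⟩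
  exact ENNReal.ofReal_le_ofReal (hA.price_le rfl hρ hdT hΔ₀ (hpos w).le)

theorem mainTheorem1 (ρ : ℝ) (hρ : 0 < ρ) (c : ℝ≥0) :
    ∃ C : ℝ, 0 < C ∧
      ∀ (d : ℕ) (_ : 0 < d)
        -- the prices of the primitive operations
        (ω : ℝ) (_ : 2 ≤ ω) (_ : ω ≤ 3) (T1 T2 TC : ℝ≥0) (_ : (d : ℝ≥0) ≤ c * T1)
        -- the subroutines
        (centre : Set (CutNC.Vec d) → CutNC.Vec d) (e : CutNC.Vec d) (_ : e ≠ 0) (τ : ℝ)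
        (_ : CutNC.CuttingPlaneAssumption ⟨c, ω, T1, T2, TC⟩ centre e τ)
        (eig : (CutNC.Vec d →L[ℝ] CutNC.Vec d) → CutNC.Vec d) (_ : CutNC.IsMinDirection eig)
        -- the function and the parameters
        (f : CutNC.Vec d → ℝ) (z₀ : CutNC.Vec d) (L₁ L₃ ε Δ : ℝ)
        (_ : 0 < L₁) (_ : 0 < L₃) (_ : 0 < ε)
        (_ : CutNC.HasLipschitzDeriv 1 L₁ f) (_ : CutNC.HasLipschitzDeriv 3 L₃ f)
        (_ : BddBelow (Set.range f)) (_ : f z₀ - ⨅ x, f x ≤ Δ)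
        -- the source of randomness
        (Ω : Type*) (_ : MeasurableSpace Ω) (Pr : Measure Ω) (_ : IsProbabilityMeasure Pr)
        (ξ : ℕ → ℕ → Ω → CutNC.Vec d) (_ : ∀ t k, Measurable (ξ t k))
        (_ : ∀ t k, pdf.IsUniform (ξ t k) (Metric.closedBall 0 1) Pr volume)
        (_ : iIndepFun (fun i : ℕ × ℕ => ξ i.1 i.2) Pr),
        ∃ Kbar : Ω → ℝ, Measurable Kbar ∧ (∀ w, 0 < Kbar w) ∧
          (∀ y : ℝ, Pr.real {w | y ≤ Kbar w} ≤ Real.exp ((1 - y) / 10)) ∧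
          ∀ᵐ w ∂Pr, ∃ m : ℕ,
            let run := CutNC.repeatedCalls ⟨c, ω, T1, T2, TC⟩ centre e τ eig f z₀ ε L₁ L₃
              (ρ * L₃ ^ (-1 / 3 : ℝ) * ε ^ (1 / 3 : ℝ)) (fun t k => ξ t k w)
            IsLeast {t : ℕ | CutNC.IsApproxStationary f ε
              (21 * ρ ^ 2 * (L₃ ^ (1 / 3 : ℝ) * ε ^ (2 / 3 : ℝ))) (run t).val} m ∧
            (run m).time ≤ ENNReal.ofReal
              (C * ((Δ * L₃ ^ (1 / 3 : ℝ) * ε ^ (-4 / 3 : ℝ) + 1) *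
                ((TC + T1 + Kbar w * d) * d / τ * CutNC.logPlus (L₁ ^ 3 / (ε ^ 2 * L₃))
                  + T2 + (d : ℝ) ^ ω))) :=
  let ⟨C, hC, h⟩ := mainTheorem1_general ρ hρ c
  ⟨C, hC, fun d hd ω _ _ T1 T2 TC hdT centre e _ τ hcut eig heig f z₀ L₁ L₃ ε Δ hL₁ hL₃ hε hlip₁
    hlip₃ hbdd hΔ Ω _ Pr _ ξ => h d hd ω T1 T2 TC hdT centre e τ hcut eig heig f z₀ L₁ L₃ ε Δ
      hL₁ hL₃ hε hlip₁ hlip₃ hbdd hΔ Ω _ Pr ξ⟩
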